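/- Setting. Let $\mathbb H_1,\mathbb H_2$ be separable Hilbert spaces and let $\mathbb H=\mathbb H_1\times\mathbb H_2$ carry the norm $\|(x,y)\|=\|x\|+\|y\|$. Let $\Omega$ be the set of continuous $\omega:\mathbb R\to\mathbb R$ with $\omega(0)=0$ and $\omega(t)/t\to0$ as $t\to\pm\infty$, with the Borel $\sigma$-algebra $\mathcal F$ of the compact-open topology, the two-sided Wiener measure $\mathbb P$ and the Wiener shift $\theta_t\omega(s)=\omega(t+s)-\omega(t)$. For $\mu>0$ let $$z^\mu_0(\omega)=\frac1\mu\int_{-\infty}^0e^{s/\mu}\,d\omega(s)=-\frac1{\mu^2}\int_{-\infty}^0e^{s/\mu}\omega(s)\,ds,\qquad z^\mu_t(\omega)=z^\mu_0(\theta_t\omega)$$ be the stationary Ornstein–Uhlenbeck process, and $\Phi^\mu_t(\omega)=\int_0^tz^\mu_s(\omega)\,ds$ the integrated Ornstein–Uhlenbeck process. Assume: (A1) $A$ generates a $C_0$-semigroup $(e^{At})_{t\ge0}$ on $\mathbb H_1$ and $B$ generates a $C_0$-group $(e^{Bt})_{t\in\mathbb R}$ on $\mathbb H_2$, with $\|e^{At}x\|\le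 e^{-\gamma_1t}\|x\|$ for $t\ge0$, $x\in\mathbb H_1$ and $\|e^{Bt}y\|\le e^{-\gamma_2t}\|y\|$ for $t\le0$, $y\in\mathbb H_2$, where $\gamma_1,\gamma_2>0$. (A2) $f:\mathbb H\to\mathbb H_1$ and $g:\mathbb H\to\mathbb H_2$ satisfy $f(0,0)=0$, $g(0,0)=0$, and for some $K>0$ both $\|f(x_1,y_1)-f(x_2,y_2)\|$ and $\|g(x_1,y_1)-g(x_2,y_2)\|$ are at most $K(\|x_1-x_2\|+\|y_1-y_2\|)$. (A3) $K<\gamma_1$. Let $\sigma\in D(A)$, let $\rho>0$ satisfy $\gamma_1-\rho>K$, and let $$0<\varepsilon<\frac{\rho}{\gamma_2+\dfrac{1}{\frac1K-\frac1{\gamma_1-\rho}}}.$$ Consider the mild formulation of the system $$\dot x=\tfrac1\varepsilon Ax+\tfrac1\varepsilon f(x,y)+\tfrac{\sigma}{\sqrt\varepsilon}\dot\Phi^\mu_t(\omega),\qquad \dot y=By+g(x,y),$$ that is, $$x(t)=e^{A(t-\tau)/\varepsilon}x(\tau)+\frac1\varepsilon\int_\tau^te^{A(t-s)/\varepsilon}f(x(s),y(s))\,ds+\frac1{\sqrt\varepsilon}\int_\tau^te^{A(t-s)/\varepsilon}\sigma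 z^\mu_s(\omega)\,ds,$$ $$y(t)=e^{B(t-\tau)}y(\tau)+\int_\tau^te^{B(t-s)}g(x(s),y(s))\,ds.$$ Statement. For every $\mu>0$: 1. For all $\omega\in\Omega$ and $\zeta\in\mathbb H$ the system has a unique continuous mild solution $t\mapsto\varphi(t,\omega,\zeta)$ on $[0,\infty)$ with initial value $\zeta$ (the equations above with $\tau=0$, $t\ge0$), and $\varphi$ is a measurable random dynamical system on $\mathbb H$ over the metric dynamical system $(\Omega,\mathcal F,\mathbb P,(\theta_t)_{t\in\mathbb R})$. 2. Let $\mathcal M^{\mu,\varepsilon}(\omega)$ be the set of all $\zeta\in\mathbb H$ for which there is a continuous $(x,y):(-\infty,0]\to\mathbb H$ with $(x(0),y(0))=\zeta$ that satisfies the equations above for all $\tau\le t\le0$ and for which $\sup_{t\le0}e^{\rho t/\varepsilon}\|x(t)\|<\infty$ and $\sup_{t\le0}e^{\rho t/\varepsilon}\|y(t)\|<\infty$. Then $\mathcal M^{\mu,\varepsilon}$ is a Lipschitz random slow manifold of $\varphi$. That is, there is a map $h^{\mu,\varepsilon}:\Omega\times\mathbb H_2\to\mathbb H_1$, measurable in $\omega$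 for each fixed $\xi$, such that $\mathcal M^{\mu,\varepsilon}(\omega)=\{(h^{\mu,\varepsilon}(\omega,\xi),\xi):\xi\in\mathbb H_2\}$ for every $\omega\in\Omega$; the sets $\mathcal M^{\mu,\varepsilon}(\omega)$ are nonempty and closed; $\omega\mapsto\inf_{z\in\mathcal M^{\mu,\varepsilon}(\omega)}\|z-w\|$ is measurable for every $w\in\mathbb H$; $\varphi(t,\omega,\mathcal M^{\mu,\varepsilon}(\omega))\subset\mathcal M^{\mu,\varepsilon}(\theta_t\omega)$ for all $t\ge0$, $\omega\in\Omega$; and for every $\omega\in\Omega$ the map $h^{\mu,\varepsilon}(\omega,\cdot)$ is Lipschitz with $$\mathrm{Lip}\,h^{\mu,\varepsilon}(\omega,\cdot)\le\frac{K}{(\gamma_1-\rho)\left[1-K\left(\frac1{\gamma_1-\rho}+\frac{\varepsilon}{\rho-\varepsilon\gamma_2}\right)\right]}.$$ -/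

import Mathlib

open MeasureTheory ProbabilityTheory Filter Set
open scoped Topology NNReal

namespace WongZakai

noncomputable section

/-! ### Canonical paths, the Wiener shift and the Wiener measure -/

/-- The canonical two-sided path space: continuous `ω : ℝ → ℝ` with `ω 0 = 0`, restricted to the
shift-invariant set (of full Wiener measure) of the paths of sublinear growth. -/
def PathSpace : Type :=
  {ω : C(ℝ, ℝ) // ω 0 = 0 ∧ Tendsto (fun t => ω t / t) atTop (𝓝 0) ∧
    Tendsto (fun t => ω t / t) atBot (𝓝 0)}

/-- The compact-open topology, restricted to `PathSpace`. -/
instance : TopologicalSpace PathSpace :=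
  inferInstanceAs (TopologicalSpace {ω : C(ℝ, ℝ) // ω 0 = 0 ∧
    Tendsto (fun t => ω t / t) atTop (𝓝 0) ∧ Tendsto (fun t => ω t / t) atBot (𝓝 0)})

/-- The Borel σ-algebra of the compact-open topology. -/
instance : MeasurableSpace PathSpace := borel PathSpace

instance : BorelSpace PathSpace := ⟨rfl⟩

instance : CoeFun PathSpace (fun _ => ℝ → ℝ) := ⟨fun ω => ω.1⟩

theorem tendsto_shift_aux {l : Filter ℝ} (hl : Tendsto (fun s : ℝ => s⁻¹) l (𝓝 0))
    (hne : ∀ᶠ s in l, s ≠ 0) (t : ℝ) (ht : Tendsto (fun s : ℝ => t + s) l l)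
    (hne' : ∀ᶠ s in l, t + s ≠ 0) {w : ℝ → ℝ} (hw : Tendsto (fun s => w s / s) l (𝓝 0)) :
    Tendsto (fun s => (w (t + s) - w t) / s) l (𝓝 0) := by
  have h1 : Tendsto (fun s : ℝ => w (t + s) / (t + s) * (t * s⁻¹ + 1) - w t * s⁻¹) l
      (𝓝 (0 * (t * 0 + 1) - w t * 0)) :=
    ((hw.comp ht).mul ((hl.const_mul t).add_const 1)).sub (hl.const_mul (w t))
  have h2 : (0 : ℝ) * (t * 0 + 1) - w t * 0 = 0 := by ring
  rw [h2] at h1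
  refine h1.congr' ?_
  filter_upwards [hne, hne'] with s hs hs'
  field_simp

/-- The Wiener shift `(θ_t ω)(s) = ω (t + s) - ω t`. -/
def shift (t : ℝ) (ω : PathSpace) : PathSpace :=
  ⟨⟨fun s => ω (t + s) - ω t, (ω.1.continuous.comp (continuous_const_add t)).sub continuous_const⟩,
    by simp,
    tendsto_shift_aux tendsto_inv_atTop_zero (eventually_ne_atTop 0) t
      (tendsto_atTop_add_const_left _ t tendsto_id)
      ((tendsto_atTop_add_const_left _ t tendsto_id).eventually_ne_atTop 0) ω.2.2.1,
    tendsto_shift_aux tendsto_inv_atBot_zero (eventually_ne_atBot 0) t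
      (tendsto_atBot_add_const_left _ t tendsto_id)
      ((tendsto_atBot_add_const_left _ t tendsto_id).eventually_ne_atBot 0) ω.2.2.2⟩

/-- `P` is the (two-sided) Wiener measure: under `P` the coordinate process is a one-dimensional
Brownian motion indexed by `ℝ`. -/
structure IsWienerMeasure (P : Measure PathSpace) : Prop where
  isProbabilityMeasure : IsProbabilityMeasure P
  increment_law : ∀ s t : ℝ, s ≤ t →
    HasLaw (fun ω : PathSpace => ω t - ω s) (gaussianReal 0 (t - s).toNNReal) P
  indep_increments : HasIndepIncrements (fun (t : ℝ) (ω : PathSpace) => ω t) P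

/-! ### The Ornstein-Uhlenbeck process and the integrated Ornstein-Uhlenbeck process -/

/-- The random variable `z₀^μ(ω) = (1/μ) ∫_{-∞}^0 e^{s/μ} dω(s)`. The integrand is smooth and
deterministic, so the integral exists path by path and is given by integration by parts (the
boundary terms vanish since `ω 0 = 0` and `ω` grows sublinearly). -/
def ouInit (μ : ℝ) (ω : PathSpace) : ℝ :=
  -(1 / μ ^ 2) * ∫ s in Iic (0 : ℝ), Real.exp (s / μ) * ω s

/-- The stationary Ornstein-Uhlenbeck process `z^μ_t(ω) = z₀^μ(θ_t ω)`. -/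
def ou (μ t : ℝ) (ω : PathSpace) : ℝ := ouInit μ (shift t ω)

/-- The integrated Ornstein-Uhlenbeck process `Φ^μ_t(ω) = ∫_0^t z^μ_s(ω) ds`. -/
def integratedOU (μ t : ℝ) (ω : PathSpace) : ℝ := ∫ s in (0 : ℝ)..t, ou μ s ω

theorem integrableOn_exp_mul_path {μ : ℝ} (hμ : 0 < μ) (ω : PathSpace) (t : ℝ) :
    IntegrableOn (fun s => Real.exp (s / μ) * ω s) (Iic t) := by
  have hcont : Continuous (fun s => Real.exp (s / μ) * ω s) := by
    have := ω.1.continuous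
    fun_prop
  refine (hcont.locallyIntegrable.locallyIntegrableOn _).integrableOn_of_isBigO_atBot
    (g := fun s => Real.exp ((1 / (2 * μ)) * s)) ?_
    ⟨Iic 0, Iic_mem_atBot 0, integrableOn_exp_mul_Iic (by positivity) 0⟩
  have h1 : ∀ᶠ s in atBot, |ω s / s| < 1 := by
    have := ω.2.2.2.abs
    rw [abs_zero] at this
    exact this.eventually_lt_const one_pos
  refine Asymptotics.IsBigO.of_bound (2 * μ) ?_
  filter_upwards [h1, eventually_lt_atBot 0] with s hs hs0
  have h2 : |ω s| ≤ -s := by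
    rw [abs_div, div_lt_one (abs_pos.2 hs0.ne), abs_of_neg hs0] at hs
    exact hs.le
  have h3 : -s ≤ 2 * μ * Real.exp (-(s / (2 * μ))) := by
    have h := Real.add_one_le_exp (-(s / (2 * μ)))
    have h' : 2 * μ * (-(s / (2 * μ))) = -s := by field_simp
    nlinarith
  have h4 : Real.exp (s / μ) = Real.exp ((1 / (2 * μ)) * s) * Real.exp (s / (2 * μ)) := by
    rw [← Real.exp_add]
    congr 1
    field_simp
    ring
  have h5 : Real.exp (s / (2 * μ)) * Real.exp (-(s / (2 * μ))) = 1 := by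
    rw [← Real.exp_add]; simp
  rw [norm_mul, Real.norm_eq_abs, Real.norm_eq_abs, Real.norm_eq_abs, Real.abs_exp, Real.abs_exp,
    h4]
  calc Real.exp ((1 / (2 * μ)) * s) * Real.exp (s / (2 * μ)) * |ω s|
      ≤ Real.exp ((1 / (2 * μ)) * s) * Real.exp (s / (2 * μ)) *
          (2 * μ * Real.exp (-(s / (2 * μ)))) := by gcongr; linarith
    _ = 2 * μ * Real.exp ((1 / (2 * μ)) * s) *
          (Real.exp (s / (2 * μ)) * Real.exp (-(s / (2 * μ)))) := by ring
    _ = 2 * μ * Real.exp ((1 / (2 * μ)) * s) := by rw [h5, mul_one]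

theorem ou_eq_aux {μ : ℝ} (hμ : 0 < μ) (t : ℝ) (ω : PathSpace) :
    ou μ t ω = ω t / μ -
      (1 / μ ^ 2) * (Real.exp (-t / μ) * ∫ r in Iic t, Real.exp (r / μ) * ω r) := by
  have hI : IntegrableOn (fun s => Real.exp (s / μ)) (Iic 0) := by
    have := integrableOn_exp_mul_Iic (a := 1 / μ) (by positivity) 0
    refine this.congr_fun (fun s _ => ?_) measurableSet_Iic
    simp only
    congr 1
    ring
  have hval : ∫ s in Iic (0 : ℝ), Real.exp (s / μ) = μ := by
    have := integral_exp_mul_Iic (a := 1 / μ) (by positivity) 0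
    simp only [mul_zero, Real.exp_zero, one_div_one_div] at this
    refine Eq.trans ?_ this
    congr 1
    ext s
    congr 1
    ring
  have hmp : MeasurePreserving (fun s : ℝ => t + s) volume volume :=
    measurePreserving_add_left volume t
  have hemb : MeasurableEmbedding (fun s : ℝ => t + s) := measurableEmbedding_addLeft t
  have hpre : (fun s : ℝ => t + s) ⁻¹' (Iic t) = Iic 0 := by
    ext s; simp
  have hcv : ∫ s in Iic (0 : ℝ), Real.exp ((t + s) / μ) * ω (t + s) =
      ∫ r in Iic t, Real.exp (r / μ) * ω r := by
    rw [← hpre]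
    exact hmp.setIntegral_preimage_emb hemb (fun r => Real.exp (r / μ) * ω r) (Iic t)
  have hint : IntegrableOn (fun s => Real.exp ((t + s) / μ) * ω (t + s)) (Iic 0) := by
    rw [← hpre]
    exact (hmp.integrableOn_comp_preimage hemb).2 (integrableOn_exp_mul_path hμ ω t)
  have hsplit : ∀ s : ℝ, Real.exp (s / μ) * (ω (t + s) - ω t) =
      Real.exp (-t / μ) * (Real.exp ((t + s) / μ) * ω (t + s)) - Real.exp (s / μ) * ω t := by
    intro s
    have : Real.exp (s / μ) = Real.exp (-t / μ) * Real.exp ((t + s) / μ) := by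
      rw [← Real.exp_add]; congr 1; ring
    rw [this]; ring
  have key : ∫ s in Iic (0 : ℝ), Real.exp (s / μ) * (ω (t + s) - ω t) =
      Real.exp (-t / μ) * (∫ r in Iic t, Real.exp (r / μ) * ω r) - μ * ω t := by
    simp_rw [hsplit]
    rw [integral_sub (hint.const_mul _) (hI.mul_const _), integral_const_mul, hcv,
      integral_mul_const, hval]
  have : ou μ t ω =
      -(1 / μ ^ 2) * ∫ s in Iic (0 : ℝ), Real.exp (s / μ) * (ω (t + s) - ω t) := rfl
  rw [this, key]
  field_simp
  ring

theorem hasDerivAt_aux {μ : ℝ} (hμ : 0 < μ) (ω : PathSpace) (t : ℝ) :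
    HasDerivAt (fun t => Real.exp (-t / μ) * ∫ r in Iic t, Real.exp (r / μ) * ω r)
      (μ * ou μ t ω) t := by
  have hcont : Continuous (fun s => Real.exp (s / μ) * ω s) := by
    have := ω.1.continuous
    fun_prop
  have h1 : HasDerivAt (fun t => ∫ r in Iic t, Real.exp (r / μ) * ω r)
      (Real.exp (t / μ) * ω t) t := by
    have h := (intervalIntegral.integral_hasDerivAt_right (hcont.intervalIntegrable 0 t)
      hcont.stronglyMeasurable.stronglyMeasurableAtFilter hcont.continuousAt).const_add
      (∫ r in Iic (0 : ℝ), Real.exp (r / μ) * ω r)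
    refine h.congr_of_eventuallyEq (Eventually.of_forall fun s => ?_)
    have := intervalIntegral.integral_Iic_sub_Iic (integrableOn_exp_mul_path hμ ω 0)
      (integrableOn_exp_mul_path hμ ω s)
    simp only
    linarith
  have h2 : HasDerivAt (fun t => Real.exp (-t / μ)) (Real.exp (-t / μ) * (-1 / μ)) t :=
    ((hasDerivAt_neg t).div_const μ).exp
  refine (h2.mul h1).congr_deriv ?_
  have h3 : Real.exp (-t / μ) * (Real.exp (t / μ) * ω t) = ω t := by
    rw [← mul_assoc, ← Real.exp_add]
    simp [neg_div]
  rw [h3, ou_eq_aux hμ]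
  field_simp
  ring

theorem continuous_ou {μ : ℝ} (hμ : 0 < μ) (ω : PathSpace) : Continuous (fun t => ou μ t ω) := by
  have h1 : Continuous (fun t => Real.exp (-t / μ) * ∫ r in Iic t, Real.exp (r / μ) * ω r) :=
    continuous_iff_continuousAt.2 fun t => (hasDerivAt_aux hμ ω t).continuousAt
  simp_rw [ou_eq_aux hμ]
  exact (ω.1.continuous.div_const μ).sub (h1.const_mul _)

/-- The process `z^μ` solves `dz = -(1/μ) z dt + (1/μ) dω`, path by path. -/
theorem ou_solves {μ : ℝ} (hμ : 0 < μ) (t : ℝ) (ω : PathSpace) :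
    ou μ t ω = ou μ 0 ω - (1 / μ) * (∫ s in (0 : ℝ)..t, ou μ s ω) + (1 / μ) * ω t := by
  have h := intervalIntegral.integral_eq_sub_of_hasDerivAt
    (fun s _ => hasDerivAt_aux hμ ω s)
    ((continuous_const.mul (continuous_ou hμ ω)).intervalIntegrable 0 t)
  rw [intervalIntegral.integral_const_mul] at h
  have h0 := ou_eq_aux hμ 0 ω
  have ht := ou_eq_aux hμ t ω
  have hω : ω 0 = 0 := ω.2.1
  rw [hω] at h0
  generalize Real.exp (-t / μ) * (∫ r in Iic t, Real.exp (r / μ) * ω r) = a at *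
  generalize Real.exp (-0 / μ) * (∫ r in Iic 0, Real.exp (r / μ) * ω r) = b at *
  have h' : (∫ s in (0 : ℝ)..t, ou μ s ω) = (a - b) / μ := by
    field_simp
    linarith
  rw [h', ht, h0]
  field_simp
  ring

/-- The derivative of the integrated process is the Ornstein-Uhlenbeck process. -/
theorem hasDerivAt_integratedOU {μ : ℝ} (hμ : 0 < μ) (t : ℝ) (ω : PathSpace) :
    HasDerivAt (fun t => integratedOU μ t ω) (ou μ t ω) t :=
  (continuous_ou hμ ω).integral_hasStrictDerivAt 0 t |>.hasDerivAt

/-! ### Operator semigroups and groups, and their generators -/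

section Semigroups

variable {H : Type*} [NormedAddCommGroup H] [NormedSpace ℝ H]

/-- `(S t)_{t ≥ 0}` is a `C₀`-semigroup (the values of `S` at negative times are irrelevant). -/
structure IsC0Semigroup (S : ℝ → H →L[ℝ] H) : Prop where
  map_zero : S 0 = ContinuousLinearMap.id ℝ H
  map_add : ∀ s t : ℝ, 0 ≤ s → 0 ≤ t → S (s + t) = (S s).comp (S t)
  tendsto_zero : ∀ x : H, Tendsto (fun t => S t x) (𝓝[>] 0) (𝓝 x)

/-- `A` is the generator of the semigroup `S`: `x ∈ D(A)` and `A x = y` if and only if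
`(S t x - x) / t → y` as `t ↓ 0`. -/
def IsSemigroupGenerator (A : H →ₗ.[ℝ] H) (S : ℝ → H →L[ℝ] H) : Prop :=
  ∀ x y : H, (x, y) ∈ A.graph ↔ Tendsto (fun t : ℝ => t⁻¹ • (S t x - x)) (𝓝[>] 0) (𝓝 y)

/-- `(U t)_{t ∈ ℝ}` is a `C₀`-group. -/
structure IsC0Group (U : ℝ → H →L[ℝ] H) : Prop where
  map_zero : U 0 = ContinuousLinearMap.id ℝ H
  map_add : ∀ s t : ℝ, U (s + t) = (U s).comp (U t)
  tendsto_zero : ∀ x : H, Tendsto (fun t => U t x) (𝓝 0) (𝓝 x)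

/-- `B` is the generator of the group `U`: `x ∈ D(B)` and `B x = y` if and only if
`(U t x - x) / t → y` as `t → 0`. -/
def IsGroupGenerator (B : H →ₗ.[ℝ] H) (U : ℝ → H →L[ℝ] H) : Prop :=
  ∀ x y : H, (x, y) ∈ B.graph ↔ Tendsto (fun t : ℝ => t⁻¹ • (U t x - x)) (𝓝[≠] 0) (𝓝 y)

end Semigroups

/-! ### Random dynamical systems, random sets, random slow manifolds -/

section Random

variable {Ω : Type*} [MeasurableSpace Ω]

/-- `(Ω, P, θ)` is a metric dynamical system. -/
structure IsMetricDynamicalSystem (P : Measure Ω) (θ : ℝ → Ω → Ω) : Prop where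
  isProbabilityMeasure : IsProbabilityMeasure P
  map_zero : θ 0 = id
  map_add : ∀ s t : ℝ, θ (t + s) = θ t ∘ θ s
  measurable : Measurable (fun p : ℝ × Ω => θ p.1 p.2)
  measure_map : ∀ t : ℝ, P.map (θ t) = P

/-- `φ` is a measurable random dynamical system on `X` over the metric dynamical system
`(Ω, P, θ)`. -/
structure IsRandomDynamicalSystem {X : Type*} [MeasurableSpace X] (P : Measure Ω)
    (θ : ℝ → Ω → Ω) (φ : ℝ≥0 → Ω → X → X) : Prop where
  base : IsMetricDynamicalSystem P θ
  measurable : Measurable (fun p : ℝ≥0 × Ω × X => φ p.1 p.2.1 p.2.2)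
  map_zero : ∀ ω, φ 0 ω = id
  cocycle : ∀ (s t : ℝ≥0) (ω : Ω), φ (t + s) ω = φ t (θ s ω) ∘ φ s ω

variable {H₁ H₂ : Type*} [NormedAddCommGroup H₁] [NormedAddCommGroup H₂]

/-- `M` is a random set in `H₁ × H₂`, where the norm of `(x, y)` is `‖x‖ + ‖y‖`. -/
structure IsRandomSet (M : Ω → Set (H₁ × H₂)) : Prop where
  nonempty : ∀ ω, (M ω).Nonempty
  isClosed : ∀ ω, IsClosed (M ω)
  measurable_dist : ∀ w : H₁ × H₂,
    Measurable (fun ω => ⨅ z : M ω, (‖z.1.1 - w.1‖ + ‖z.1.2 - w.2‖))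

/-- `M` is a Lipschitz random slow manifold of `φ`, the graph of `h`. -/
structure IsRandomSlowManifold [MeasurableSpace H₁] (θ : ℝ → Ω → Ω)
    (φ : ℝ≥0 → Ω → H₁ × H₂ → H₁ × H₂) (M : Ω → Set (H₁ × H₂)) (h : Ω → H₂ → H₁) : Prop where
  isRandomSet : IsRandomSet M
  eq_graph : ∀ ω, M ω = {ζ | ∃ ξ : H₂, ζ = (h ω ξ, ξ)}
  invariant : ∀ (t : ℝ≥0) (ω : Ω), φ t ω '' M ω ⊆ M (θ t ω)
  lipschitz : ∀ ω, ∃ L : ℝ≥0, LipschitzWith L (h ω)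
  measurable : ∀ ξ : H₂, Measurable (fun ω => h ω ξ)

end Random

/-! ### The Wong-Zakai system -/

section System

variable {H₁ H₂ : Type*} [NormedAddCommGroup H₁] [InnerProductSpace ℝ H₁]
  [NormedAddCommGroup H₂] [InnerProductSpace ℝ H₂]

/-- The mild (variation of constants) form, on `[τ, t]`, of the system
`ε x' = A x + f(x, y) + √ε σ Φ'`, `y' = B y + g(x, y)`, for `z = (x, y)`, where `S t = e^{At}`,
`U t = e^{Bt}` and `Φ' = z^μ` is the derivative of the integrated Ornstein-Uhlenbeck process. -/
def MildEq (S : ℝ → H₁ →L[ℝ] H₁) (U : ℝ → H₂ →L[ℝ] H₂) (f : H₁ × H₂ → H₁) (g : H₁ × H₂ → H₂)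
    (σ : H₁) (ε μ : ℝ) (ω : PathSpace) (z : ℝ → H₁ × H₂) (τ t : ℝ) : Prop :=
  (z t).1 = S ((t - τ) / ε) (z τ).1
      + (1 / ε) • (∫ s in τ..t, S ((t - s) / ε) (f (z s)))
      + (1 / √ε) • (∫ s in τ..t, ou μ s ω • S ((t - s) / ε) σ) ∧
  (z t).2 = U (t - τ) (z τ).2 + ∫ s in τ..t, U (t - s) (g (z s))

/-- `z` is, on `[0, ∞)`, a mild solution with initial value `ζ`. -/
structure IsForwardSolution (S : ℝ → H₁ →L[ℝ] H₁) (U : ℝ → H₂ →L[ℝ] H₂) (f : H₁ × H₂ → H₁)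
    (g : H₁ × H₂ → H₂) (σ : H₁) (ε μ : ℝ) (ω : PathSpace) (ζ : H₁ × H₂) (z : ℝ → H₁ × H₂) :
    Prop where
  continuousOn : ContinuousOn z (Ici 0)
  initial : z 0 = ζ
  mild : ∀ t : ℝ, 0 ≤ t → MildEq S U f g σ ε μ ω z 0 t

/-- `z` is, on `(-∞, 0]`, a mild solution with value `ζ` at time `0`. -/
structure IsBackwardSolution (S : ℝ → H₁ →L[ℝ] H₁) (U : ℝ → H₂ →L[ℝ] H₂) (f : H₁ × H₂ → H₁)
    (g : H₁ × H₂ → H₂) (σ : H₁) (ε μ : ℝ) (ω : PathSpace) (ζ : H₁ × H₂) (z : ℝ → H₁ × H₂) :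
    Prop where
  continuousOn : ContinuousOn z (Iic 0)
  final : z 0 = ζ
  mild : ∀ τ t : ℝ, τ ≤ t → t ≤ 0 → MildEq S U f g σ ε μ ω z τ t

/-- `φ` is the solution map of the system: for all `ω` and `ζ`, the function `t ↦ φ t ω ζ` is the
one and only mild solution on `[0, ∞)` with initial value `ζ`. -/
def IsSolutionMap (S : ℝ → H₁ →L[ℝ] H₁) (U : ℝ → H₂ →L[ℝ] H₂) (f : H₁ × H₂ → H₁)
    (g : H₁ × H₂ → H₂) (σ : H₁) (ε μ : ℝ) (φ : ℝ≥0 → PathSpace → H₁ × H₂ → H₁ × H₂) : Prop :=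
  ∀ (ω : PathSpace) (ζ : H₁ × H₂) (z : ℝ → H₁ × H₂),
    IsForwardSolution S U f g σ ε μ ω ζ z ↔ ∀ t : ℝ≥0, z t = φ t ω ζ

/-- The weighted space `C_α^-` of the continuous `x : (-∞, 0] → H` with
`sup_{t ≤ 0} e^{-α t} ‖x t‖ < ∞`. -/
def MemWeighted {H : Type*} [NormedAddCommGroup H] (α : ℝ) (x : ℝ → H) : Prop :=
  ContinuousOn x (Iic 0) ∧ ∃ C : ℝ, ∀ t : ℝ, t ≤ 0 → Real.exp (-α * t) * ‖x t‖ ≤ C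

/-- The set of the `ζ` through which there is a backward mild solution in the product space
`C_α^{1,-} × C_α^{2,-}` with `α = -ρ/ε`. -/
def slowManifold (S : ℝ → H₁ →L[ℝ] H₁) (U : ℝ → H₂ →L[ℝ] H₂) (f : H₁ × H₂ → H₁)
    (g : H₁ × H₂ → H₂) (σ : H₁) (ρ ε μ : ℝ) (ω : PathSpace) : Set (H₁ × H₂) :=
  {ζ | ∃ z : ℝ → H₁ × H₂, IsBackwardSolution S U f g σ ε μ ω ζ z ∧
    MemWeighted (-(ρ / ε)) (fun t => (z t).1) ∧ MemWeighted (-(ρ / ε)) (fun t => (z t).2)}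

end System

end

end WongZakai

open WongZakai

namespace WongZakai

/-! ### The path space -/

/-! The noise enters through a path that is continuous in time and tempered, meaning that it grows
more slowly than every exponential. So the system is solved path by path, as a Lipschitz equation
with a continuous forcing term. Probability is needed only for the base flow, and measurability only
in the parameter `ω`.

Base flow. Evaluations generate the Borel σ-algebra of the path space, so a Wiener measure is
determined by its finite-dimensional laws, hence by its increments. The shift translates the
increments and keeps their law, so the image of `P` under a shift is again a Wiener measure and
equals `P`.

Forward flow. On the product space the system is one variation of constants equation. Picard
iteration contracts in a sup norm with weight `exp (lam * t)` on all of `[0, ∞)`. The iterates are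
jointly measurable in path, initial value and time, and so is their pointwise limit. The cocycle
property is uniqueness applied to a solution restarted at a later time.

Slow manifold. Put `a = γ₁ / ε`, `b = ρ / ε`, `γ = γ₂`, so that `γ < b < a`. For a backward solution
growing at most like `exp (-b * t)`, the decay rate `a` of the semigroup erases the contribution of
the remote past. Hence `x(t)` is the integral of its drift over `(-∞, t]`, while `y` is recovered
from `y(0) = ξ` through the group. Such solutions are therefore the fixed points of the
Lyapunov-Perron operator. In the weighted sum norm its contraction constant is `L₁ / (a - b) + L₂ /
(b - γ)` with `L₁ = K / ε`, `L₂ = K`, that is `K / (γ₁ - ρ) + K * ε / (ρ - ε * γ₂)`. The bound on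
`ε` makes it less than `1`. Each `ξ` thus carries exactly one solution on `(-∞, 0]`, the manifold is
the graph of `h ω ξ = x(0)`, and comparing two fixed points gives the Lipschitz constant. Invariance
holds because a backward solution prolonged by the forward flow and shifted in time is again a
backward solution with the same growth rate. -/

theorem isInducing_toContinuousMap : Topology.IsInducing (fun ω : PathSpace => ω.1) :=
  Topology.IsInducing.subtypeVal

theorem continuous_toContinuousMap : Continuous (fun ω : PathSpace => ω.1) :=
  isInducing_toContinuousMap.continuous

instance : SecondCountableTopology PathSpace :=
  isInducing_toContinuousMap.secondCountableTopology

theorem continuous_path_eval : Continuous (fun p : PathSpace × ℝ => p.1 p.2) :=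
  (continuous_eval (F := C(ℝ, ℝ))).comp
    ((continuous_toContinuousMap.comp continuous_fst).prodMk continuous_snd)

theorem measurable_path_eval (t : ℝ) : Measurable (fun ω : PathSpace => ω t) :=
  (continuous_path_eval.comp (Continuous.prodMk_left t)).measurable

theorem shift_apply (t : ℝ) (ω : PathSpace) (s : ℝ) : shift t ω s = ω (t + s) - ω t := rfl

theorem path_ext {ω ω' : PathSpace} (h : ∀ s, ω s = ω' s) : ω = ω' :=
  Subtype.ext (ContinuousMap.ext h)

theorem continuous_shift : Continuous (fun p : ℝ × PathSpace => shift p.1 p.2) := by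
  refine Continuous.subtype_mk (ContinuousMap.continuous_of_continuous_uncurry _ ?_) _
  have h1 : Continuous fun q : (ℝ × PathSpace) × ℝ => q.1.2 (q.1.1 + q.2) :=
    continuous_path_eval.comp (g := fun p : PathSpace × ℝ => p.1 p.2)
      (f := fun q : (ℝ × PathSpace) × ℝ => (q.1.2, q.1.1 + q.2)) (by fun_prop)
  have h2 : Continuous fun q : (ℝ × PathSpace) × ℝ => q.1.2 q.1.1 :=
    continuous_path_eval.comp (g := fun p : PathSpace × ℝ => p.1 p.2)
      (f := fun q : (ℝ × PathSpace) × ℝ => (q.1.2, q.1.1)) (by fun_prop)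
  exact h1.sub h2

theorem measurable_shift : Measurable (fun p : ℝ × PathSpace => shift p.1 p.2) :=
  continuous_shift.measurable

theorem measurable_shift_right (t : ℝ) : Measurable (shift t) :=
  measurable_shift.comp measurable_prodMk_left

theorem shift_zero : shift 0 = id := by
  funext ω
  refine path_ext fun s => ?_
  have : ω 0 = 0 := ω.2.1
  simp [shift_apply, this]

theorem shift_add (s t : ℝ) : shift (t + s) = shift t ∘ shift s := by
  funext ω
  refine path_ext fun r => ?_
  simp only [shift_apply, Function.comp_apply]
  rw [show s + (t + r) = t + s + r by ring, add_comm s t]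
  ring

/-- By compactness `Φ x` maps `K` into `U` exactly when its distance to `Uᶜ` is bounded below by
some `1 / (n + 1)` on `K`. By continuity a countable dense subset of `K` suffices, which leaves
countably many conditions on evaluations. -/
theorem measurableSet_mapsTo {X : Type*} [MeasurableSpace X] {Φ : X → C(ℝ, ℝ)}
    (hΦ : ∀ t, Measurable fun x => Φ x t) {K U : Set ℝ} (hK : IsCompact K) (hU : IsOpen U) :
    MeasurableSet {x | MapsTo (Φ x) K U} := by
  -- `Metric.infDist` to the empty set is `0` by convention, so the case `U = univ` has to be
  -- separated.
  by_cases hUne : (Uᶜ).Nonempty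
  swap
  · have : U = univ := by
      rw [not_nonempty_iff_eq_empty] at hUne
      simpa using hUne
    simp [this]
  obtain ⟨D, hDK, hDc, hKD⟩ :=
    (TopologicalSpace.IsSeparable.of_separableSpace K).exists_countable_dense_subset
  have key : {x | MapsTo (Φ x) K U} =
      ⋃ n : ℕ, ⋂ d ∈ D, {x | (1 : ℝ) / (n + 1) ≤ Metric.infDist (Φ x d) Uᶜ} := by
    ext x
    simp only [mem_ofPred_eq, mem_iUnion, mem_iInter]
    have hc : Continuous fun r => Metric.infDist (Φ x r) Uᶜ :=
      (Metric.continuous_infDist_pt _).comp (Φ x).continuous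
    constructor
    · intro h
      rcases K.eq_empty_or_nonempty with hKe | hKne
      · exact ⟨0, fun d hd => by simpa [hKe] using hDK hd⟩
      · obtain ⟨r, hr, hmin⟩ := hK.exists_isMinOn hKne hc.continuousOn
        have hpos : 0 < Metric.infDist (Φ x r) Uᶜ := by
          rw [← hU.isClosed_compl.notMem_iff_infDist_pos hUne]
          simpa using h hr
        obtain ⟨n, hn⟩ := exists_nat_one_div_lt hpos
        exact ⟨n, fun d hd => hn.le.trans (hmin (hDK hd))⟩
    · rintro ⟨n, hn⟩ r hr
      have hcl : IsClosed {r | (1 : ℝ) / (n + 1) ≤ Metric.infDist (Φ x r) Uᶜ} :=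
        isClosed_le continuous_const hc
      have := closure_minimal (fun d hd => hn d hd) hcl (hKD hr)
      have hpos : 0 < Metric.infDist (Φ x r) Uᶜ := lt_of_lt_of_le (by positivity) this
      rw [← hU.isClosed_compl.notMem_iff_infDist_pos hUne] at hpos
      simpa using hpos
  rw [key]
  refine MeasurableSet.iUnion fun n => MeasurableSet.biInter hDc fun d _ => ?_
  exact measurableSet_le measurable_const ((Metric.continuous_infDist_pt _).measurable.comp (hΦ d))

/-- The Borel σ-algebra of the path space is generated by the evaluations. -/
theorem measurableSpace_pathSpace_le_comap :
    (inferInstance : MeasurableSpace PathSpace) ≤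
      MeasurableSpace.comap (fun (ω : PathSpace) (t : ℝ) => ω t) MeasurableSpace.pi := by
  set m : MeasurableSpace PathSpace :=
    MeasurableSpace.comap (fun (ω : PathSpace) (t : ℝ) => ω t) MeasurableSpace.pi with hm
  have hev : ∀ t, Measurable[m] fun ω : PathSpace => ω t := fun t =>
    (measurable_pi_apply t).comp (comap_measurable _)
  have h1 : (borel PathSpace) = MeasurableSpace.comap (fun ω : PathSpace => ω.1) (borel C(ℝ, ℝ)) :=
    (congrArg (@borel PathSpace) isInducing_toContinuousMap.eq_induced).trans borel_comap
  change borel PathSpace ≤ m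
  -- Since `C(ℝ, ℝ)` is second countable, the compact-open subbasis already generates its Borel
  -- sets.
  rw [h1, borel_eq_generateFrom_of_subbasis (ContinuousMap.compactOpen_eq)]
  rw [← measurable_iff_comap_le]
  refine measurable_generateFrom ?_
  rintro _ ⟨K, hK, U, hU, rfl⟩
  exact measurableSet_mapsTo hev hK hU

/-- Independence of increments will be used along a monotone sequence of times indexed by `ℕ`. A
finite set is listed in increasing order and then continued by its largest element, which only adds
zero increments. -/
theorem exists_monotone_nat_range (I : Finset ℝ) :
    ∃ t : ℕ → ℝ, Monotone t ∧ ∀ s ∈ I, ∃ k, t k = s := by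
  rcases I.eq_empty_or_nonempty with rfl | hI
  · exact ⟨fun _ => 0, monotone_const, by simp⟩
  obtain ⟨n, hn⟩ : ∃ n, I.card = n + 1 := Nat.exists_eq_add_one.2 hI.card_pos
  refine ⟨fun i => I.orderEmbOfFin hn ⟨min n i, by omega⟩, fun a b hab => ?_, fun s hs => ?_⟩
  · refine (I.orderEmbOfFin hn).monotone ?_
    simp only [Fin.mk_le_mk]
    omega
  · have : s ∈ Set.range (I.orderEmbOfFin hn) := by
      rw [Finset.range_orderEmbOfFin]; exact hs
    obtain ⟨k, rfl⟩ := this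
    refine ⟨k, ?_⟩
    change I.orderEmbOfFin hn _ = _
    congr 1
    apply Fin.ext
    simp only
    omega

/-- The Wiener measure is determined by its defining properties. -/
theorem IsWienerMeasure.unique {P Q : Measure PathSpace} (hP : IsWienerMeasure P)
    (hQ : IsWienerMeasure Q) : P = Q := by
  have := hP.isProbabilityMeasure
  have := hQ.isProbabilityMeasure
  let e : PathSpace → ℝ → ℝ := fun ω t => ω t
  have he : Measurable e := measurable_pi_lambda _ measurable_path_eval
  have hfin : ∀ I : Finset ℝ, (P.map e).map I.restrict = (Q.map e).map I.restrict := by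
    intro I
    -- Time `0` is included because `ω 0 = 0` anchors the path: its values are then functions of its
    -- increments.
    obtain ⟨t, ht, htI⟩ := exists_monotone_nat_range (insert 0 I)
    let Δ : PathSpace → ℕ → ℝ := fun ω i => ω (t (i + 1)) - ω (t i)
    have hΔ : Measurable Δ := measurable_pi_lambda _ fun i =>
      (measurable_path_eval _).sub (measurable_path_eval _)
    have hlaw : ∀ R : Measure PathSpace, IsWienerMeasure R →
        R.map Δ = Measure.infinitePi fun i => gaussianReal 0 (t (i + 1) - t i).toNNReal := by
      intro R hR
      exact (iIndepFun.hasLaw_infinitePi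
        (fun i => hR.increment_law (t i) (t (i + 1)) (ht (Nat.le_succ i)))
        (hR.indep_increments.nat ht) hΔ.aemeasurable).map_eq
    choose! k hk using htI
    -- Both sums telescope from the first time `t 0`, which may be negative. Their difference is `ω
    -- s - ω 0 = ω s`.
    let L : (ℕ → ℝ) → I → ℝ := fun v s =>
      (∑ i ∈ Finset.range (k s.1), v i) - ∑ i ∈ Finset.range (k 0), v i
    have hL : Measurable L := by
      refine measurable_pi_lambda _ fun s => ?_
      fun_prop
    have hcomp : I.restrict ∘ e = L ∘ Δ := by
      funext ω
      funext s
      have h0 : ω 0 = 0 := ω.2.1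
      simp only [Function.comp_apply, Finset.restrict, L, Δ, e]
      rw [Finset.sum_range_sub (fun i => ω (t i)), Finset.sum_range_sub (fun i => ω (t i)),
        hk s.1 (Finset.mem_insert_of_mem s.2), hk 0 (Finset.mem_insert_self 0 I), h0]
      ring
    have hr : Measurable (I.restrict : (ℝ → ℝ) → (I → ℝ)) :=
      measurable_pi_lambda _ fun _ => measurable_pi_apply _
    rw [Measure.map_map hr he, Measure.map_map hr he, hcomp, ← Measure.map_map hL hΔ,
      ← Measure.map_map hL hΔ, hlaw P hP, hlaw Q hQ]
  have hmap : P.map e = Q.map e := by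
    have : ∀ I : Finset ℝ, IsFiniteMeasure ((Q.map e).map I.restrict) := fun I => inferInstance
    exact IsProjectiveLimit.unique (P := fun I => (Q.map e).map I.restrict) hfin fun I => rfl
  ext A hA
  obtain ⟨A', hA', rfl⟩ := measurableSpace_pathSpace_le_comap A hA
  rw [← Measure.map_apply he hA', hmap, Measure.map_apply he hA']

/-- An increment of the shifted path over `[a, b]` is the increment of the path over `[t + a, t +
b]`, and both defining properties depend on increments through time differences only. -/
theorem IsWienerMeasure.map_shift {P : Measure PathSpace} (hP : IsWienerMeasure P) (t : ℝ) :
    IsWienerMeasure (P.map (shift t)) := by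
  have := hP.isProbabilityMeasure
  have hm := measurable_shift_right t
  have hsub : ∀ a b : ℝ, Measurable fun ω : PathSpace => ω b - ω a := fun a b =>
    (measurable_path_eval b).sub (measurable_path_eval a)
  have hinc : ∀ a b : ℝ, (P.map (shift t)).map (fun ω : PathSpace => ω b - ω a) =
      P.map fun ω : PathSpace => ω (t + b) - ω (t + a) := by
    intro a b
    rw [Measure.map_map (hsub a b) hm]
    congr 1
    funext ω
    simp [shift_apply]
  have hPt := Measure.isProbabilityMeasure_map (μ := P) hm.aemeasurable
  refine ⟨hPt, fun a b hab => ⟨(hsub a b).aemeasurable, ?_⟩, fun n τ hτ => ?_⟩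
  · rw [hinc, (hP.increment_law (t + a) (t + b) (by linarith)).map_eq]
    congr 2
    ring
  · have hi := hP.indep_increments n (fun i => t + τ i) fun i j hij => by
      have := hτ hij
      simp only
      linarith
    refine (iIndepFun_iff_map_fun_eq_pi_map fun i => (hsub _ _).aemeasurable).2 ?_
    have hi' := (iIndepFun_iff_map_fun_eq_pi_map fun i => (hsub _ _).aemeasurable).1 hi
    have hvec : Measurable fun (ω : PathSpace) (i : Fin n) => ω (τ i.succ) - ω (τ i.castSucc) :=
      measurable_pi_lambda _ fun i => hsub _ _
    rw [Measure.map_map hvec hm]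
    refine Eq.trans ?_ (hi'.trans ?_)
    · congr 1
      funext ω i
      simp [shift_apply]
    · congr 1
      funext i
      exact (hinc _ _).symm

theorem isMetricDynamicalSystem_shift {P : Measure PathSpace} (hP : IsWienerMeasure P) :
    IsMetricDynamicalSystem P shift where
  isProbabilityMeasure := hP.isProbabilityMeasure
  map_zero := shift_zero
  map_add := shift_add
  measurable := measurable_shift
  measure_map t := (hP.map_shift t).unique hP

/-! ### The Ornstein-Uhlenbeck process -/

theorem ou_add (μ s t : ℝ) (ω : PathSpace) : ou μ (s + t) ω = ou μ s (shift t ω) := by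
  simp [ou, shift_add]

theorem measurable_ouInit (μ : ℝ) : Measurable (ouInit μ) := by
  refine Measurable.const_mul ?_ _
  have h : Continuous fun p : PathSpace × ℝ => Real.exp (p.2 / μ) * p.1 p.2 :=
    Continuous.mul (by fun_prop) continuous_path_eval
  exact (h.stronglyMeasurable.integral_prod_right' (ν := volume.restrict (Iic 0))).measurable

theorem measurable_ou (μ : ℝ) : Measurable fun p : ℝ × PathSpace => ou μ p.1 p.2 :=
  (measurable_ouInit μ).comp measurable_shift

/-- Sublinear growth gives `|ω t| ≤ |t|` outside a compact interval, on which the path is bounded;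
and `|t| ≤ exp (δ * |t|) / δ`. -/
theorem exists_path_le_exp (ω : PathSpace) {δ : ℝ} (hδ : 0 < δ) :
    ∃ C, 0 ≤ C ∧ ∀ t, |ω t| ≤ C * Real.exp (δ * |t|) := by
  have hc : Continuous fun t => ω t := ω.1.continuous
  have htop : ∀ᶠ t in atTop, |ω t| ≤ |t| := by
    have := ω.2.2.1.abs
    rw [abs_zero] at this
    filter_upwards [this.eventually_lt_const one_pos, eventually_gt_atTop 0] with t ht ht0
    rw [abs_div, div_lt_one (abs_pos.2 ht0.ne')] at ht
    exact ht.le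
  have hbot : ∀ᶠ t in atBot, |ω t| ≤ |t| := by
    have := ω.2.2.2.abs
    rw [abs_zero] at this
    filter_upwards [this.eventually_lt_const one_pos, eventually_lt_atBot 0] with t ht ht0
    rw [abs_div, div_lt_one (abs_pos.2 ht0.ne)] at ht
    exact ht.le
  obtain ⟨b, hb⟩ := eventually_atTop.1 htop
  obtain ⟨a, ha⟩ := eventually_atBot.1 hbot
  obtain ⟨M, hM⟩ := isCompact_Icc.exists_bound_of_continuousOn (s := Icc a b) hc.continuousOn
  refine ⟨1 / δ + |M|, by positivity, fun t => ?_⟩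
  have h1 : |t| ≤ 1 / δ * Real.exp (δ * |t|) := by
    have := Real.add_one_le_exp (δ * |t|)
    rw [one_div, inv_mul_eq_div, le_div_iff₀ hδ]
    linarith
  have h2 : |M| ≤ |M| * Real.exp (δ * |t|) :=
    le_mul_of_one_le_right (abs_nonneg _) (Real.one_le_exp (by positivity))
  have h3 : |ω t| ≤ |t| + |M| := by
    rcases le_total b t with h | h
    · linarith [hb t h, abs_nonneg M]
    rcases le_total t a with h' | h'
    · linarith [ha t h', abs_nonneg M]
    · have := hM t ⟨h', h⟩
      rw [Real.norm_eq_abs] at this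
      linarith [abs_nonneg t, le_abs_self M]
  rw [add_mul]
  linarith

/-- Temperedness of the noise. It puts the forcing term into the weighted space, whatever the rate
of the weight. -/
theorem exists_ou_le_exp {μ : ℝ} (hμ : 0 < μ) (ω : PathSpace) {δ : ℝ} (hδ : 0 < δ) :
    ∃ C, 0 ≤ C ∧ ∀ t, |ou μ t ω| ≤ C * Real.exp (δ * |t|) := by
  -- The cap `1 / (2 * μ)` keeps the growth of the path below the decay of the kernel `exp (r / μ)`,
  -- so the integral over `(-∞, 0]` converges.
  set d := min δ (1 / (2 * μ)) with hd
  have hd0 : 0 < d := lt_min hδ (by positivity)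
  have hdμ : 0 < 1 / μ - d := by
    have h1 : d ≤ 1 / (2 * μ) := min_le_right _ _
    have h2 : 1 / (2 * μ) < 1 / μ := by
      apply one_div_lt_one_div_of_lt hμ; linarith
    linarith
  obtain ⟨C, hC0, hC⟩ := exists_path_le_exp ω hd0
  refine ⟨1 / μ ^ 2 * (2 * C * (1 / (1 / μ - d))), by positivity, fun t => ?_⟩
  have hexp : Real.exp (d * |t|) ≤ Real.exp (δ * |t|) :=
    Real.exp_le_exp.2 (mul_le_mul_of_nonneg_right (min_le_left _ _) (abs_nonneg _))
  have hint := (integrableOn_exp_mul_Iic (a := 1 / μ - d) hdμ 0).const_mul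
    (2 * C * Real.exp (d * |t|))
  have hb : ∀ r ∈ Iic (0 : ℝ), ‖Real.exp (r / μ) * shift t ω r‖ ≤
      2 * C * Real.exp (d * |t|) * Real.exp ((1 / μ - d) * r) := by
    intro r hr
    have hr' : |r| = -r := abs_of_nonpos hr
    have e1 : Real.exp (d * |t + r|) ≤ Real.exp (d * |t|) * Real.exp (-d * r) := by
      rw [← Real.exp_add]
      refine Real.exp_le_exp.2 ?_
      have := mul_le_mul_of_nonneg_left (abs_add_le t r) hd0.le
      rw [hr'] at this
      linarith
    have e2 : Real.exp (d * |t|) ≤ Real.exp (d * |t|) * Real.exp (-d * r) :=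
      le_mul_of_one_le_right (Real.exp_pos _).le (Real.one_le_exp (by
        have : r ≤ 0 := hr
        nlinarith))
    have e3 : |shift t ω r| ≤ 2 * C * (Real.exp (d * |t|) * Real.exp (-d * r)) := by
      rw [shift_apply]
      have h1 := abs_sub (ω (t + r)) (ω t)
      have h2 := (hC (t + r)).trans (mul_le_mul_of_nonneg_left e1 hC0)
      have h3 := (hC t).trans (mul_le_mul_of_nonneg_left e2 hC0)
      linarith
    rw [norm_mul, Real.norm_eq_abs, Real.norm_eq_abs, Real.abs_exp]
    calc Real.exp (r / μ) * |shift t ω r|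
        ≤ Real.exp (r / μ) * (2 * C * (Real.exp (d * |t|) * Real.exp (-d * r))) := by gcongr
      _ = 2 * C * Real.exp (d * |t|) * (Real.exp (r / μ) * Real.exp (-d * r)) := by ring
      _ = _ := by
        rw [← Real.exp_add]
        congr 2
        ring
  have hnorm := norm_integral_le_of_norm_le hint (ae_restrict_of_forall_mem measurableSet_Iic hb)
  rw [integral_const_mul, integral_exp_mul_Iic hdμ, mul_zero, Real.exp_zero] at hnorm
  have hC' : 0 ≤ 1 / μ ^ 2 * (2 * C * (1 / (1 / μ - d))) := by positivity
  calc |ou μ t ω| = 1 / μ ^ 2 * ‖∫ r in Iic (0 : ℝ), Real.exp (r / μ) * shift t ω r‖ := by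
        rw [ou, ouInit, abs_mul, abs_neg, abs_of_nonneg (by positivity), Real.norm_eq_abs]
    _ ≤ 1 / μ ^ 2 * (2 * C * Real.exp (d * |t|) * (1 / (1 / μ - d))) := by gcongr
    _ = 1 / μ ^ 2 * (2 * C * (1 / (1 / μ - d))) * Real.exp (d * |t|) := by ring
    _ ≤ _ := by gcongr

section Mild

variable {E : Type*} [NormedAddCommGroup E] [NormedSpace ℝ E]

/-! ### Jointly continuous semigroups -/

/-- A semigroup for nonnegative times, extended to a jointly continuous family on `ℝ`. -/
structure IsContSemigroup (V : ℝ → E →L[ℝ] E) : Prop where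
  map_zero : V 0 = ContinuousLinearMap.id ℝ E
  map_add : ∀ s t : ℝ, 0 ≤ s → 0 ≤ t → V (s + t) = (V s).comp (V t)
  continuous : Continuous fun p : ℝ × E => V p.1 p.2

theorem exists_bound_Icc_of_strongly_continuous [CompleteSpace E] {V : ℝ → E →L[ℝ] E}
    (hV : ∀ x, Continuous fun t => V t x) (a b : ℝ) :
    ∃ M, ∀ t ∈ Icc a b, ‖V t‖ ≤ M := by
  obtain ⟨M, hM⟩ := banach_steinhaus (g := fun t : Icc a b => V t) fun x => by
    obtain ⟨C, hC⟩ := isCompact_Icc.exists_bound_of_continuousOn (s := Icc a b) (hV x).continuousOn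
    exact ⟨C, fun t => hC t t.2⟩
  exact ⟨M, fun t ht => hM ⟨t, ht⟩⟩

/-- Banach-Steinhaus bounds `‖V t‖` near `t₀`, so the error from varying the vector is controlled
uniformly in time. -/
theorem continuous_uncurry_of_strongly_continuous [CompleteSpace E] {V : ℝ → E →L[ℝ] E}
    (hV : ∀ x, Continuous fun t => V t x) : Continuous fun p : ℝ × E => V p.1 p.2 := by
  rw [continuous_iff_continuousAt]
  rintro ⟨t₀, x₀⟩
  obtain ⟨M, hM⟩ := exists_bound_Icc_of_strongly_continuous hV (t₀ - 1) (t₀ + 1)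
  rw [ContinuousAt, tendsto_iff_norm_sub_tendsto_zero]
  have h1 : Tendsto (fun p : ℝ × E => M * ‖p.2 - x₀‖ + ‖V p.1 x₀ - V t₀ x₀‖) (𝓝 (t₀, x₀))
      (𝓝 (M * ‖x₀ - x₀‖ + ‖V t₀ x₀ - V t₀ x₀‖)) := by
    refine Continuous.tendsto (f := fun p : ℝ × E => M * ‖p.2 - x₀‖ + ‖V p.1 x₀ - V t₀ x₀‖) ?_
      (t₀, x₀)
    have := (hV x₀).comp (continuous_fst (X := ℝ) (Y := E))
    simp only [Function.comp_def] at this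
    fun_prop
  simp only [sub_self, norm_zero, mul_zero, add_zero] at h1
  refine squeeze_zero' (Eventually.of_forall fun _ => norm_nonneg _) ?_ h1
  have h2 : ∀ᶠ p : ℝ × E in 𝓝 (t₀, x₀), p.1 ∈ Icc (t₀ - 1) (t₀ + 1) :=
    continuous_fst.continuousAt.eventually (Icc_mem_nhds (by simp) (by simp))
  filter_upwards [h2] with p hp
  have h3 : V p.1 p.2 - V t₀ x₀ = V p.1 (p.2 - x₀) + (V p.1 x₀ - V t₀ x₀) := by
    rw [map_sub]; abel
  rw [h3]
  exact (norm_add_le _ _).trans (add_le_add_left ((V p.1).le_of_opNorm_le (hM _ hp) _) _)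

namespace IsContSemigroup

variable {V : ℝ → E →L[ℝ] E}

theorem apply_add (hV : IsContSemigroup V) {s t : ℝ} (hs : 0 ≤ s) (ht : 0 ≤ t) (x : E) :
    V s (V t x) = V (s + t) x := by
  rw [hV.map_add s t hs ht]; rfl

/-- Split `t` into its integer and fractional parts: the fractional part costs a factor `M`, each
unit step another one. The rate is `log M`, nonnegative because `M` is taken at least `1`. -/
theorem exists_exp_bound [CompleteSpace E] (hV : IsContSemigroup V) :
    ∃ M k : ℝ, 0 ≤ M ∧ 0 ≤ k ∧ ∀ t, 0 ≤ t → ‖V t‖ ≤ M * Real.exp (k * t) := by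
  obtain ⟨M₀, hM₀⟩ := exists_bound_Icc_of_strongly_continuous
    (fun x => hV.continuous.comp (Continuous.prodMk_left x)) 0 1
  set M := max M₀ 1
  have hM1 : 1 ≤ M := le_max_right _ _
  have hM : ∀ t ∈ Icc (0 : ℝ) 1, ‖V t‖ ≤ M := fun t ht => (hM₀ t ht).trans (le_max_left _ _)
  refine ⟨M, Real.log M, by positivity, Real.log_nonneg hM1, ?_⟩
  have key : ∀ n : ℕ, ∀ r ∈ Icc (0 : ℝ) 1, ‖V (n + r)‖ ≤ M * M ^ n := by
    intro n
    induction n with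
    | zero => intro r hr; simpa using hM r hr
    | succ n ih =>
      intro r hr
      have : V ((n + 1 : ℕ) + r) = (V 1).comp (V (n + r)) := by
        rw [← hV.map_add 1 _ zero_le_one (add_nonneg n.cast_nonneg hr.1)]
        congr 1
        push_cast
        ring
      rw [this]
      calc _ ≤ ‖V 1‖ * ‖V (n + r)‖ := ContinuousLinearMap.opNorm_comp_le _ _
        _ ≤ M * (M * M ^ n) := mul_le_mul (hM 1 (by simp)) (ih r hr) (norm_nonneg _) (by positivity)
        _ = _ := by ring
  intro t ht
  have h1 := key ⌊t⌋₊ (t - ⌊t⌋₊) ⟨by linarith [Nat.floor_le ht], by linarith [Nat.lt_floor_add_one t]⟩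
  rw [add_sub_cancel] at h1
  refine h1.trans (mul_le_mul_of_nonneg_left ?_ (by positivity))
  rw [Real.exp_mul, Real.exp_log (by positivity), ← Real.rpow_natCast]
  exact Real.rpow_le_rpow_of_exponent_le hM1 (Nat.floor_le ht)

theorem prodMap {E' : Type*} [NormedAddCommGroup E'] [NormedSpace ℝ E'] {V' : ℝ → E' →L[ℝ] E'}
    (hV : IsContSemigroup V) (hV' : IsContSemigroup V') :
    IsContSemigroup fun t => (V t).prodMap (V' t) where
  map_zero := by
    rw [hV.map_zero, hV'.map_zero]; rfl
  map_add s t hs ht := by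
    rw [hV.map_add s t hs ht, hV'.map_add s t hs ht]; rfl
  continuous := by
    have h1 := hV.continuous.comp
      (show Continuous fun p : ℝ × E × E' => (p.1, p.2.1) by fun_prop)
    have h2 := hV'.continuous.comp
      (show Continuous fun p : ℝ × E × E' => (p.1, p.2.2) by fun_prop)
    exact h1.prodMk h2

theorem comp_div (hV : IsContSemigroup V) {ε : ℝ} (hε : 0 < ε) :
    IsContSemigroup fun t => V (t / ε) where
  map_zero := by rw [zero_div, hV.map_zero]
  map_add s t hs ht := by rw [add_div, hV.map_add _ _ (by positivity) (by positivity)]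
  continuous := hV.continuous.comp (show Continuous fun p : ℝ × E => (p.1 / ε, p.2) by fun_prop)

theorem continuousOn_conv (hV : IsContSemigroup V) {φ : ℝ → E} {s : Set ℝ}
    (hφ : ContinuousOn φ s) (t : ℝ) : ContinuousOn (fun r => V (t - r) (φ r)) s :=
  hV.continuous.comp_continuousOn (ContinuousOn.prodMk (by fun_prop) hφ)

theorem intervalIntegrable_conv (hV : IsContSemigroup V) {φ : ℝ → E} {a b : ℝ}
    (hφ : ContinuousOn φ (uIcc a b)) (t : ℝ) :
    IntervalIntegrable (fun r => V (t - r) (φ r)) volume a b :=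
  (hV.continuousOn_conv hφ t).intervalIntegrable

/-- The operator identity is asked only on the interval of integration. This serves a semigroup
moved forward as well as a group moved in either direction. -/
theorem map_integral_conv [CompleteSpace E] (hV : IsContSemigroup V) {φ : ℝ → E} {a b m : ℝ}
    (hφ : ContinuousOn φ (uIcc a b)) {t : ℝ} (W : E →L[ℝ] E)
    (hW : ∀ s ∈ uIcc a b, W.comp (V (m - s)) = V (t - s)) :
    W (∫ s in a..b, V (m - s) (φ s)) = ∫ s in a..b, V (t - s) (φ s) := by
  rw [← W.intervalIntegral_comp_comm (hV.intervalIntegrable_conv hφ m)]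
  refine intervalIntegral.integral_congr fun s hs => ?_
  exact congrArg (fun A : E →L[ℝ] E => A (φ s)) (hW s hs)

theorem integral_conv_split [CompleteSpace E] (hV : IsContSemigroup V) {φ : ℝ → E} {τ m t : ℝ}
    (hτm : τ ≤ m) (hmt : m ≤ t) (hφ : ContinuousOn φ (Icc τ t)) :
    V (t - m) (∫ s in τ..m, V (m - s) (φ s)) + ∫ s in m..t, V (t - s) (φ s) =
      ∫ s in τ..t, V (t - s) (φ s) := by
  have h1 : ContinuousOn φ (uIcc τ m) := hφ.mono (by
    rw [uIcc_of_le hτm]; exact Icc_subset_Icc_right hmt)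
  have h2 : ContinuousOn φ (uIcc m t) := hφ.mono (by
    rw [uIcc_of_le hmt]; exact Icc_subset_Icc_left hτm)
  rw [hV.map_integral_conv (t := t) h1 (V (t - m)) fun s hs => by
    rw [uIcc_of_le hτm] at hs
    rw [← hV.map_add _ _ (by linarith) (by linarith [hs.2])]
    congr 1
    ring]
  exact intervalIntegral.integral_add_adjacent_intervals
    (hV.intervalIntegrable_conv h1 t) (hV.intervalIntegrable_conv h2 t)

end IsContSemigroup

/-! ### Mild solutions -/

/-- The variation of constants formula on `[τ, t]`. -/
def Mild (V : ℝ → E →L[ℝ] E) (F : ℝ → E → E) (z : ℝ → E) (τ t : ℝ) : Prop :=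
  z t = V (t - τ) (z τ) + ∫ s in τ..t, V (t - s) (F s (z s))

variable {V : ℝ → E →L[ℝ] E} {F : ℝ → E → E}

theorem Mild.congr {z z' : ℝ → E} {τ t : ℝ} (h : Mild V F z τ t) (hτt : τ ≤ t)
    (hz : ∀ s ∈ Icc τ t, z s = z' s) : Mild V F z' τ t := by
  unfold Mild at *
  rw [← hz t (right_mem_Icc.2 hτt), ← hz τ (left_mem_Icc.2 hτt), h]
  congr 1
  refine intervalIntegral.integral_congr fun s hs => ?_
  rw [uIcc_of_le hτt] at hs
  simp only [hz s hs]

theorem continuousOn_comp_uncurry {X Y Z : Type*} [TopologicalSpace X] [TopologicalSpace Y]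
    [TopologicalSpace Z] {F : X → Y → Z} (hF : Continuous (Function.uncurry F)) {z : X → Y}
    {s : Set X} (hz : ContinuousOn z s) : ContinuousOn (fun r => F r (z r)) s :=
  hF.comp_continuousOn (ContinuousOn.prodMk (by fun_prop) hz)

/-- Concatenation and restriction of mild solutions in one statement: one direction glues a backward
to a forward solution, the other restarts a solution at a later time. -/
theorem Mild.iff_of_left [CompleteSpace E] (hV : IsContSemigroup V)
    (hF : Continuous (Function.uncurry F)) {z : ℝ → E} {τ m t : ℝ} (hτm : τ ≤ m) (hmt : m ≤ t)
    (hz : ContinuousOn z (Icc τ t)) (h : Mild V F z τ m) :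
    Mild V F z m t ↔ Mild V F z τ t := by
  unfold Mild at *
  have h1 := hV.integral_conv_split hτm hmt (continuousOn_comp_uncurry hF hz)
  have h2 : V (t - m) (z m) = V (t - τ) (z τ) +
      V (t - m) (∫ s in τ..m, V (m - s) (F s (z s))) := by
    conv_lhs => rw [h]
    rw [map_add, hV.apply_add (by linarith) (by linarith)]
    congr 3
    ring
  rw [h2, ← h1, add_assoc]

theorem Mild.comp_add {z : ℝ → E} {τ t r : ℝ} :
    Mild V (fun s => F (r + s)) (fun s => z (r + s)) τ t ↔ Mild V F z (r + τ) (r + t) := by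
  unfold Mild
  have h := intervalIntegral.integral_comp_add_left (a := τ) (b := t)
    (fun s => V (r + t - s) (F s (z s))) r
  rw [← h]
  simp only [add_sub_add_left_eq_sub]

theorem integral_exp_conv {p q : ℝ} (hpq : q - p ≠ 0) (a b c : ℝ) :
    ∫ s in a..b, Real.exp (p * (c - s)) * Real.exp (q * s) =
      Real.exp (p * c) * ((Real.exp ((q - p) * b) - Real.exp ((q - p) * a)) / (q - p)) := by
  have h : ∀ s, Real.exp (p * (c - s)) * Real.exp (q * s) =
      Real.exp (p * c) * Real.exp ((q - p) * s) := by
    intro s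
    rw [← Real.exp_add, ← Real.exp_add]
    congr 1
    ring
  simp_rw [h]
  rw [intervalIntegral.integral_const_mul, intervalIntegral.integral_comp_mul_left _ hpq,
    integral_exp, smul_eq_mul, inv_mul_eq_div]

theorem norm_integral_le_exp_conv {φ : ℝ → E} {a b c p q D : ℝ} (hab : a ≤ b) (hpq : q - p ≠ 0)
    (h : ∀ s ∈ Icc a b, ‖φ s‖ ≤ D * (Real.exp (p * (c - s)) * Real.exp (q * s))) :
    ‖∫ s in a..b, φ s‖ ≤
      D * (Real.exp (p * c) * ((Real.exp ((q - p) * b) - Real.exp ((q - p) * a)) / (q - p))) := by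
  rw [← integral_exp_conv hpq, ← intervalIntegral.integral_const_mul]
  refine intervalIntegral.norm_integral_le_of_norm_le hab
    (Eventually.of_forall fun s hs => h s (Ioc_subset_Icc_self hs)) ?_
  exact Continuous.intervalIntegrable (by fun_prop) _ _

end Mild

/-! ### Picard iteration in weighted spaces -/

/-- A bound that improves itself under an affine contraction. -/
theorem le_of_forall_bound_imp {X : Type*} {N w : X → ℝ} {κ δ : ℝ}
    (hκ0 : 0 ≤ κ) (hκ1 : κ < 1) (hC : ∃ C, ∀ t, N t ≤ C * w t)
    (h : ∀ C, (∀ t, N t ≤ C * w t) → ∀ t, N t ≤ (κ * C + δ) * w t) (t : X) :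
    N t ≤ δ / (1 - κ) * w t := by
  obtain ⟨C, hC⟩ := hC
  have hκ : 1 - κ ≠ 0 := by linarith
  -- The `n`-th iterate of `C ↦ κ * C + δ`, written around its fixed point `δ / (1 - κ)`.
  have key : ∀ n : ℕ, ∀ t, N t ≤ (κ ^ n * (C - δ / (1 - κ)) + δ / (1 - κ)) * w t := by
    intro n
    induction n with
    | zero => intro t; simpa using hC t
    | succ n ih =>
      intro t
      refine (h _ ih t).trans (le_of_eq ?_)
      congr 1
      field_simp
      ring
  have hlim : Tendsto (fun n : ℕ => (κ ^ n * (C - δ / (1 - κ)) + δ / (1 - κ)) * w t) atTop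
      (𝓝 ((0 * (C - δ / (1 - κ)) + δ / (1 - κ)) * w t)) :=
    (((tendsto_pow_atTop_nhds_zero_of_lt_one hκ0 hκ1).mul_const _).add_const _).mul_const _
  rw [zero_mul, zero_add] at hlim
  exact ge_of_tendsto' hlim fun n => key n t

/-- Banach's fixed point theorem in a weighted sup norm, carried out on plain functions. `N` stands
for a norm equivalent to that of `E`: the gap condition belongs to the sum norm, whereas `H₁ × H₂`
carries the maximum norm, hence the factor `2`. The pointwise limit of the iterates started at `0`
is recorded because measurability in the parameter passes through it. -/
theorem exists_fixedPoint_of_weighted_contraction {E : Type*} [NormedAddCommGroup E]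
    [CompleteSpace E] {N : E → ℝ}
    (hN₁ : ∀ e, ‖e‖ ≤ N e) (hN₂ : ∀ e, N e ≤ 2 * ‖e‖) {w : ℝ → ℝ} (hw : Continuous w)
    (hw0 : ∀ t, 0 < w t) {κ : ℝ} (hκ0 : 0 ≤ κ) (hκ1 : κ < 1) (T : (ℝ → E) → ℝ → E)
    (hTc : ∀ z, Continuous z → (∃ C, ∀ t, ‖z t‖ ≤ C * w t) → Continuous (T z))
    (hT0 : ∃ C, ∀ t, ‖T 0 t‖ ≤ C * w t)
    (hTL : ∀ z z', Continuous z → Continuous z' → (∃ C, ∀ t, ‖z t‖ ≤ C * w t) →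
      (∃ C, ∀ t, ‖z' t‖ ≤ C * w t) → ∀ C, (∀ t, N (z t - z' t) ≤ C * w t) →
      ∀ t, N (T z t - T z' t) ≤ κ * C * w t) :
    ∃ z, Continuous z ∧ (∃ C, ∀ t, ‖z t‖ ≤ C * w t) ∧ T z = z ∧
      ∀ t, Tendsto (fun n => T^[n] 0 t) atTop (𝓝 (z t)) := by
  have hzero : ∃ C, ∀ t, ‖(0 : ℝ → E) t‖ ≤ C * w t := ⟨0, fun t => by simp⟩
  have hbdd : ∀ z, Continuous z → (∃ C, ∀ t, ‖z t‖ ≤ C * w t) → ∃ C, ∀ t, ‖T z t‖ ≤ C * w t := by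
    rintro z hz ⟨C, hC⟩
    obtain ⟨C₀, hC₀⟩ := hT0
    refine ⟨κ * (2 * C) + C₀, fun t => ?_⟩
    have h1 := hTL z 0 hz continuous_zero ⟨C, hC⟩ hzero (2 * C) (fun t => by
      rw [Pi.zero_apply, sub_zero]
      have := hC t
      linarith [hN₂ (z t)]) t
    have h2 := norm_sub_norm_le (T z t) (T 0 t)
    have h3 := hN₁ (T z t - T 0 t)
    rw [add_mul]
    linarith [hC₀ t]
  have hit : ∀ n, Continuous (T^[n] 0) ∧ ∃ C, ∀ t, ‖T^[n] 0 t‖ ≤ C * w t := by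
    intro n
    induction n with
    | zero => exact ⟨continuous_zero, hzero⟩
    | succ n ih =>
      rw [Function.iterate_succ_apply']
      exact ⟨hTc _ ih.1 ih.2, hbdd _ ih.1 ih.2⟩
  obtain ⟨C₀, hC₀⟩ := hT0
  have hstep : ∀ n t, N (T^[n + 1] 0 t - T^[n] 0 t) ≤ 2 * C₀ * κ ^ n * w t := by
    intro n
    induction n with
    | zero =>
      intro t
      have := hN₂ (T 0 t)
      simp only [zero_add, Function.iterate_one, Function.iterate_zero, id, Pi.zero_apply, sub_zero,
        pow_zero, mul_one]
      linarith [hC₀ t]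
    | succ n ih =>
      intro t
      have := hTL _ _ (hit (n + 1)).1 (hit n).1 (hit (n + 1)).2 (hit n).2 _ ih t
      rw [← Function.iterate_succ_apply' T, ← Function.iterate_succ_apply' T] at this
      refine this.trans (le_of_eq ?_)
      ring
  have hdist : ∀ t n, dist (T^[n] 0 t) (T^[n + 1] 0 t) ≤ 2 * C₀ * w t * κ ^ n := by
    intro t n
    rw [dist_comm, dist_eq_norm]
    refine (hN₁ _).trans ((hstep n t).trans (le_of_eq ?_))
    ring
  have hlim : ∀ t, ∃ e, Tendsto (fun n => T^[n] 0 t) atTop (𝓝 e) := fun t =>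
    cauchySeq_tendsto_of_complete (cauchySeq_of_le_geometric κ _ hκ1 (hdist t))
  choose z hz using hlim
  have herr : ∀ n t, ‖z t - T^[n] 0 t‖ ≤ 2 * C₀ / (1 - κ) * κ ^ n * w t := by
    intro n t
    have := dist_le_of_le_geometric_of_tendsto κ _ hκ1 (hdist t) (hz t) n
    rw [dist_comm, dist_eq_norm] at this
    refine this.trans (le_of_eq ?_)
    ring
  have hpow : ∀ D r : ℝ, Tendsto (fun n : ℕ => D * κ ^ n * r) atTop (𝓝 0) := by
    intro D r
    simpa using ((tendsto_pow_atTop_nhds_zero_of_lt_one hκ0 hκ1).const_mul D).mul_const r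
  have hC₀0 : 0 ≤ C₀ := by
    have := (norm_nonneg _).trans (hC₀ 0)
    exact nonneg_of_mul_nonneg_left this (hw0 0)
  have hκ' : 0 < 1 - κ := by linarith
  have hzc : Continuous z := by
    -- Convergence is uniform only relative to `w`; since `w` is locally bounded, it is locally
    -- uniform and the limit is continuous.
    have hloc : TendstoLocallyUniformly (fun n t => T^[n] 0 t) z atTop := by
      rw [Metric.tendstoLocallyUniformly_iff]
      intro η hη t
      have hwt : ∀ᶠ s in 𝓝 t, w s < w t + 1 :=
        hw.continuousAt.eventually_lt_const (by linarith)
      refine ⟨_, hwt, ?_⟩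
      filter_upwards [(hpow (2 * C₀ / (1 - κ)) (w t + 1)).eventually_lt_const hη] with n hn s hs
      rw [dist_eq_norm]
      refine lt_of_le_of_lt (herr n s) (lt_of_le_of_lt ?_ hn)
      have hs' : w s < w t + 1 := hs
      gcongr
    exact hloc.continuous (Frequently.of_forall fun n => (hit n).1)
  have hzb : ∃ C, ∀ t, ‖z t‖ ≤ C * w t := by
    refine ⟨2 * C₀ / (1 - κ), fun t => ?_⟩
    simpa using herr 0 t
  refine ⟨z, hzc, hzb, ?_, hz⟩
  funext t
  refine tendsto_nhds_unique (f := fun n => T^[n + 1] 0 t) (l := atTop) ?_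
    ((tendsto_add_atTop_iff_nat 1).2 (hz t))
  rw [tendsto_iff_norm_sub_tendsto_zero]
  refine squeeze_zero (fun _ => norm_nonneg _) (fun n => ?_)
    (hpow (κ * (2 * (2 * C₀ / (1 - κ)))) (w t))
  rw [norm_sub_rev, Function.iterate_succ_apply']
  have := hTL z (T^[n] 0) hzc (hit n).1 hzb (hit n).2 (2 * (2 * C₀ / (1 - κ)) * κ ^ n) (fun s => by
    have h1 := herr n s
    have h2 := hN₂ (z s - T^[n] 0 s)
    linarith) t
  refine (hN₁ _).trans (this.trans (le_of_eq ?_))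
  ring

section Forward

variable {E : Type*} [NormedAddCommGroup E] [NormedSpace ℝ E] {V : ℝ → E →L[ℝ] E}

/-! ### Forward mild solutions -/

theorem norm_integral_conv_le {M k lam D c : ℝ} (hM : 0 ≤ M) (hk : k < lam) (hc : 0 ≤ c)
    (hV : ∀ t, 0 ≤ t → ‖V t‖ ≤ M * Real.exp (k * t)) {φ : ℝ → E}
    (hφ : ∀ s ∈ Icc 0 c, ‖φ s‖ ≤ D * Real.exp (lam * s)) :
    ‖∫ s in (0 : ℝ)..c, V (c - s) (φ s)‖ ≤ M * D / (lam - k) * Real.exp (lam * c) := by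
  have hD : 0 ≤ D := by
    have := (norm_nonneg _).trans (hφ 0 (left_mem_Icc.2 hc))
    simpa using this
  have h := norm_integral_le_exp_conv (φ := fun s => V (c - s) (φ s)) (a := 0) (b := c) (c := c)
    (p := k) (q := lam) (D := M * D) hc (by linarith) fun s hs => by
      refine ((V (c - s)).le_opNorm _).trans ?_
      have h1 := hV (c - s) (by linarith [hs.2])
      refine (mul_le_mul h1 (hφ s hs) (norm_nonneg _) (by positivity)).trans (le_of_eq ?_)
      ring
  refine h.trans ?_
  have h2 : Real.exp (k * c) * Real.exp ((lam - k) * c) = Real.exp (lam * c) := by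
    rw [← Real.exp_add]; congr 1; ring
  have h3 : 0 < lam - k := by linarith
  calc M * D * (Real.exp (k * c) * ((Real.exp ((lam - k) * c) - Real.exp ((lam - k) * 0)) /
        (lam - k)))
      ≤ M * D * (Real.exp (k * c) * (Real.exp ((lam - k) * c) / (lam - k))) := by
        gcongr
        linarith [Real.exp_pos ((lam - k) * 0)]
    _ = M * D / (lam - k) * (Real.exp (k * c) * Real.exp ((lam - k) * c)) := by ring
    _ = _ := by rw [h2]

theorem norm_integral_conv_sub_le (hVs : IsContSemigroup V) {M k lam L C c : ℝ} (hM : 0 ≤ M)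
    (hk : k < lam) (hc : 0 ≤ c) (hV : ∀ t, 0 ≤ t → ‖V t‖ ≤ M * Real.exp (k * t))
    {F : ℝ → E → E} (hF : Continuous (Function.uncurry F))
    (hL : 0 ≤ L) (hFL : ∀ s p q, ‖F s p - F s q‖ ≤ L * ‖p - q‖) {z z' : ℝ → E}
    (hz : ContinuousOn z (Icc 0 c)) (hz' : ContinuousOn z' (Icc 0 c))
    (h : ∀ s ∈ Icc 0 c, ‖z s - z' s‖ ≤ C * Real.exp (lam * s)) :
    ‖(∫ s in (0 : ℝ)..c, V (c - s) (F s (z s))) - ∫ s in (0 : ℝ)..c, V (c - s) (F s (z' s))‖ ≤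
      M * L / (lam - k) * C * Real.exp (lam * c) := by
  rw [← uIcc_of_le hc] at hz hz'
  rw [← intervalIntegral.integral_sub
    (hVs.intervalIntegrable_conv (continuousOn_comp_uncurry hF hz) c)
    (hVs.intervalIntegrable_conv (continuousOn_comp_uncurry hF hz') c)]
  simp_rw [← map_sub]
  refine (norm_integral_conv_le (D := L * C) hM hk hc hV fun s hs => ?_).trans (le_of_eq ?_)
  · refine (hFL s _ _).trans ?_
    rw [mul_assoc]
    exact mul_le_mul_of_nonneg_left (h s hs) hL
  · ring

/-- In the norm weighted by `exp (lam * s)` the difference of two solutions is at most half of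
itself, hence zero. This replaces Gronwall's inequality. -/
theorem mild_unique [CompleteSpace E] (hVs : IsContSemigroup V) {F : ℝ → E → E}
    (hF : Continuous (Function.uncurry F)) {L : ℝ} (hL : 0 ≤ L)
    (hFL : ∀ s p q, ‖F s p - F s q‖ ≤ L * ‖p - q‖)
    {z z' : ℝ → E} (hz : ContinuousOn z (Ici 0)) (hz' : ContinuousOn z' (Ici 0))
    (h0 : z 0 = z' 0) (hm : ∀ t, 0 ≤ t → Mild V F z 0 t) (hm' : ∀ t, 0 ≤ t → Mild V F z' 0 t)
    {t : ℝ} (ht : 0 ≤ t) : z t = z' t := by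
  obtain ⟨M, k, hM, hk, hV⟩ := hVs.exists_exp_bound
  -- The choice makes `M * L / (lam - k) ≤ 1 / 2`; the summand `1` keeps `lam - k` positive.
  set lam := k + 2 * M * L + 1 with hlam
  have hML : 0 ≤ M * L := by positivity
  have hkl : k < lam := by linarith
  have hκ : M * L / (lam - k) ≤ 1 / 2 := by
    rw [div_le_iff₀ (by linarith)]; linarith
  have hsub : ∀ {s}, s ≤ t → Icc 0 s ⊆ Ici (0 : ℝ) := fun _ r hr => hr.1
  obtain ⟨C, hC⟩ := isCompact_Icc.exists_bound_of_continuousOn (s := Icc 0 t)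
    ((hz.sub hz').mono (hsub le_rfl))
  have key := le_of_forall_bound_imp (X := Icc (0 : ℝ) t) (N := fun s => ‖z s - z' s‖)
    (w := fun s => Real.exp (lam * s)) (κ := 1 / 2) (δ := 0) (by norm_num) (by norm_num)
    ⟨|C|, fun s => by
      have h1 := (hC s s.2).trans (le_abs_self C)
      refine h1.trans (le_mul_of_one_le_right (abs_nonneg _) (Real.one_le_exp ?_))
      have := s.2.1
      have : 0 ≤ lam := by linarith
      positivity⟩
    (fun C hC s => by
      have h1 := norm_integral_conv_sub_le hVs hM hkl s.2.1 hV hF hL hFL (hz.mono (hsub s.2.2))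
        (hz'.mono (hsub s.2.2)) (C := C) (fun r hr => hC ⟨r, hr.1, hr.2.trans s.2.2⟩)
      have hC0 : 0 ≤ C := by
        have := (norm_nonneg _).trans (hC ⟨0, left_mem_Icc.2 ht⟩)
        simpa using this
      have h2 : z s - z' s = (∫ r in (0 : ℝ)..s, V (s - r) (F r (z r))) -
          ∫ r in (0 : ℝ)..s, V (s - r) (F r (z' r)) := by
        rw [show z s = _ from hm s s.2.1, show z' s = _ from hm' s s.2.1, h0]
        abel
      simp only [h2]
      refine h1.trans ?_
      rw [add_zero]
      gcongr)
    ⟨t, right_mem_Icc.2 ht⟩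
  simp only [zero_div, zero_mul] at key
  exact sub_eq_zero.1 (norm_le_zero_iff.1 key)

/-- The right-hand side of the variation of constants formula on `[0, t]`, frozen for negative
times. -/
noncomputable def forwardOp (V : ℝ → E →L[ℝ] E) (F : ℝ → E → E) (ζ : E) (z : ℝ → E) (t : ℝ) : E :=
  V (max t 0) ζ + ∫ s in (0 : ℝ)..max t 0, V (max t 0 - s) (F s (z s))

theorem continuous_forwardOp (hVs : IsContSemigroup V) {F : ℝ → E → E}
    (hF : Continuous (Function.uncurry F)) (ζ : E) {z : ℝ → E} (hz : Continuous z) :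
    Continuous (forwardOp V F ζ z) := by
  have hφ : Continuous fun s => F s (z s) := hF.comp (continuous_id.prodMk hz)
  refine Continuous.add ?_ ?_
  · exact hVs.continuous.comp
      (f := fun t : ℝ => (max t 0, ζ)) (by fun_prop)
  · refine intervalIntegral.continuous_parametric_intervalIntegral_of_continuous
      (f := fun t s => V (max t 0 - s) (F s (z s))) ?_ (by fun_prop)
    exact hVs.continuous.comp
      (f := fun p : ℝ × ℝ => (max p.1 0 - p.2, F p.2 (z p.2))) (by fun_prop)

/-- The weight `exp (lam * t)` makes the operator a contraction on the whole half-line at once, so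
no local solutions are pieced together. Since `lam ≥ 1`, the weight dominates the growth `exp s` of
the forcing. -/
theorem exists_fixedPoint_forwardOp [CompleteSpace E] (hVs : IsContSemigroup V) {F : ℝ → E → E}
    (hF : Continuous (Function.uncurry F)) {L : ℝ} (hL : 0 ≤ L)
    (hFL : ∀ s p q, ‖F s p - F s q‖ ≤ L * ‖p - q‖)
    (hF0 : ∃ C, ∀ s, 0 ≤ s → ‖F s 0‖ ≤ C * Real.exp s) (ζ : E) :
    ∃ z, Continuous z ∧ forwardOp V F ζ z = z ∧
      ∀ t, Tendsto (fun n => (forwardOp V F ζ)^[n] 0 t) atTop (𝓝 (z t)) := by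
  obtain ⟨M, k, hM, hk, hV⟩ := hVs.exists_exp_bound
  obtain ⟨C₀, hC₀⟩ := hF0
  set lam := k + 2 * M * L + 1 with hlam
  have hML : 0 ≤ M * L := by positivity
  have hkl : k < lam := by linarith
  have hκ : M * L / (lam - k) ≤ 1 / 2 := by
    rw [div_le_iff₀ (by linarith)]; linarith
  have hC₀0 : 0 ≤ C₀ := by
    have := (norm_nonneg _).trans (hC₀ 0 le_rfl)
    simpa using this
  obtain ⟨z, hz, -, hfix, hlim⟩ := exists_fixedPoint_of_weighted_contraction (N := fun e : E => ‖e‖)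
    (fun _ => le_rfl) (fun e => by linarith [norm_nonneg e])
    (w := fun t => Real.exp (lam * max t 0)) (by fun_prop) (fun _ => Real.exp_pos _)
    (κ := 1 / 2) (by norm_num) (by norm_num) (forwardOp V F ζ)
    (fun z hz _ => continuous_forwardOp hVs hF ζ hz)
    ⟨M * ‖ζ‖ + M * C₀ / (lam - k), fun t => by
      have hc : 0 ≤ max t 0 := le_max_right _ _
      rw [add_mul]
      refine norm_add_le_of_le ?_ (norm_integral_conv_le hM hkl hc hV fun s hs => ?_)
      · refine ((V _).le_of_opNorm_le (hV _ hc) ζ).trans ?_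
        rw [mul_right_comm]
        gcongr
      · refine (hC₀ s hs.1).trans ?_
        gcongr
        have := hs.1
        nlinarith⟩
    (fun z z' hz hz' _ _ C hC t => by
      have hc : 0 ≤ max t 0 := le_max_right _ _
      have h1 := norm_integral_conv_sub_le hVs hM hkl hc hV hF hL hFL hz.continuousOn
        hz'.continuousOn (C := C) (fun r hr => by
          have := hC r
          rwa [max_eq_left hr.1] at this)
      have hC0 : 0 ≤ C := by
        have := (norm_nonneg _).trans (hC 0)
        simpa using this
      simp only [forwardOp, add_sub_add_left_eq_sub]
      refine h1.trans ?_
      gcongr)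
  exact ⟨z, hz, hfix, hlim⟩

theorem measurable_iterate_forwardOp [MeasurableSpace E] [BorelSpace E]
    [SecondCountableTopology E] (hVs : IsContSemigroup V) {Θ : Type*} [MeasurableSpace Θ]
    {F : Θ → ℝ → E → E} (hFm : Measurable fun q : Θ × ℝ × E => F q.1 q.2.1 q.2.2) (n : ℕ) :
    Measurable fun q : (Θ × E) × ℝ => (forwardOp V (F q.1.1) q.1.2)^[n] 0 q.2 := by
  have hVm : Measurable fun p : ℝ × E => V p.1 p.2 := hVs.continuous.measurable
  induction n with
  | zero => exact measurable_const
  | succ n ih =>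
    simp only [Function.iterate_succ_apply']
    set Z := fun q : (Θ × E) × ℝ => (forwardOp V (F q.1.1) q.1.2)^[n] 0 q.2 with hZ
    have h1 : Measurable fun q : (Θ × E) × ℝ => V (max q.2 0) q.1.2 :=
      hVm.comp (f := fun q : (Θ × E) × ℝ => (max q.2 0, q.1.2)) (by fun_prop)
    have h2 : Measurable fun p : ((Θ × E) × ℝ) × ℝ =>
        V (max p.1.2 0 - p.2) (F p.1.1.1 p.2 (Z (p.1.1, p.2))) := by
      refine hVm.comp (f := fun p : ((Θ × E) × ℝ) × ℝ =>
        (max p.1.2 0 - p.2, F p.1.1.1 p.2 (Z (p.1.1, p.2)))) (Measurable.prodMk (by fun_prop) ?_)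
      refine hFm.comp (f := fun p : ((Θ × E) × ℝ) × ℝ => (p.1.1.1, p.2, Z (p.1.1, p.2))) ?_
      fun_prop
    -- An integral with moving endpoint becomes the integral over `ℝ` of a jointly measurable
    -- indicator, which is measurable in the remaining variables.
    have hset : MeasurableSet {p : ((Θ × E) × ℝ) × ℝ | 0 < p.2 ∧ p.2 ≤ max p.1.2 0} :=
      (measurableSet_lt measurable_const measurable_snd).inter
        (measurableSet_le measurable_snd (by fun_prop))
    have h3 := ((h2.indicator hset).stronglyMeasurable.integral_prod_right'
      (ν := (volume : Measure ℝ))).measurable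
    refine h1.add ?_
    convert h3 using 2 with q
    rw [intervalIntegral.integral_of_le (le_max_right _ _), ← integral_indicator measurableSet_Ioc]
    rfl

/-- The solution flow of the variation of constants equation, jointly measurable in the parameter,
the initial value and time. -/
theorem exists_measurable_forward_flow [CompleteSpace E] [MeasurableSpace E] [BorelSpace E]
    [SecondCountableTopology E] (hVs : IsContSemigroup V) {Θ : Type*} [MeasurableSpace Θ]
    {F : Θ → ℝ → E → E} (hFm : Measurable fun q : Θ × ℝ × E => F q.1 q.2.1 q.2.2)
    (hF : ∀ θ, Continuous (Function.uncurry (F θ))) {L : ℝ} (hL : 0 ≤ L)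
    (hFL : ∀ θ s p q, ‖F θ s p - F θ s q‖ ≤ L * ‖p - q‖)
    (hF0 : ∀ θ, ∃ C, ∀ s, 0 ≤ s → ‖F θ s 0‖ ≤ C * Real.exp s) :
    ∃ Z : Θ → E → ℝ → E, (∀ θ ζ, Continuous (Z θ ζ)) ∧ (∀ θ ζ, Z θ ζ 0 = ζ) ∧
      (∀ θ ζ t, 0 ≤ t → Mild V (F θ) (Z θ ζ) 0 t) ∧
      Measurable fun q : (Θ × E) × ℝ => Z q.1.1 q.1.2 q.2 := by
  choose Z hZc hZfix hZlim using fun θ ζ =>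
    exists_fixedPoint_forwardOp hVs (hF θ) hL (hFL θ) (hF0 θ) ζ
  have h0 : ∀ θ ζ, Z θ ζ 0 = ζ := by
    intro θ ζ
    rw [← hZfix θ ζ]
    simp [forwardOp, hVs.map_zero]
  refine ⟨Z, hZc, h0, fun θ ζ t ht => ?_, ?_⟩
  · unfold Mild
    rw [h0]
    conv_lhs => rw [← hZfix θ ζ]
    simp [forwardOp, max_eq_left ht]
  · exact measurable_of_tendsto_metrizable (fun n => measurable_iterate_forwardOp hVs hFm n)
      (tendsto_pi_nhds.2 fun q => hZlim q.1.1 q.1.2 q.2)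

end Forward

section Backward

variable {H₁ H₂ : Type*} [NormedAddCommGroup H₁] [NormedSpace ℝ H₁] [NormedAddCommGroup H₂]
  [NormedSpace ℝ H₂]

/-! ### The Lyapunov-Perron operator -/

/-- A stable semigroup and a group with an exponential gap `γ < b < a`, together with Lipschitz
constants that fulfil the gap condition. -/
structure IsDichotomy (S : ℝ → H₁ →L[ℝ] H₁) (U : ℝ → H₂ →L[ℝ] H₂) (a b γ L₁ L₂ : ℝ) : Prop where
  semigroup : IsContSemigroup S
  group : IsContSemigroup U
  group_add : ∀ s t : ℝ, U (s + t) = (U s).comp (U t)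
  norm_semigroup_le : ∀ t, 0 ≤ t → ∀ x, ‖S t x‖ ≤ Real.exp (-a * t) * ‖x‖
  norm_group_le : ∀ t, t ≤ 0 → ∀ y, ‖U t y‖ ≤ Real.exp (-γ * t) * ‖y‖
  lt_weight : γ < b
  weight_lt : b < a
  nonneg_left : 0 ≤ L₁
  nonneg_right : 0 ≤ L₂
  gap : L₁ / (a - b) + L₂ / (b - γ) < 1

/-- Continuous nonlinearities, Lipschitz with respect to the sum norm, of exponential growth at
`-∞` along the zero solution. -/
structure IsNonlinearity (F₁ : ℝ → H₁ × H₂ → H₁) (F₂ : ℝ → H₁ × H₂ → H₂) (b L₁ L₂ : ℝ) :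
    Prop where
  continuous_left : Continuous (Function.uncurry F₁)
  continuous_right : Continuous (Function.uncurry F₂)
  lipschitz_left : ∀ s p q, ‖F₁ s p - F₁ s q‖ ≤ L₁ * (‖(p - q).1‖ + ‖(p - q).2‖)
  lipschitz_right : ∀ s p q, ‖F₂ s p - F₂ s q‖ ≤ L₂ * (‖(p - q).1‖ + ‖(p - q).2‖)
  growth_left : ∃ C, ∀ s, s ≤ 0 → ‖F₁ s 0‖ ≤ C * Real.exp (-b * s)
  growth_right : ∃ C, ∀ s, s ≤ 0 → ‖F₂ s 0‖ ≤ C * Real.exp (-b * s)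

variable {S : ℝ → H₁ →L[ℝ] H₁} {U : ℝ → H₂ →L[ℝ] H₂} {a b γ L₁ L₂ : ℝ}

namespace IsDichotomy

/-- The semigroup decays at rate `a` while `φ` grows backward at the smaller rate `b`; what remains
is the integral of `exp ((a - b) * s)`. -/
theorem integrableOn_conv (hd : IsDichotomy S U a b γ L₁ L₂) {φ : ℝ → H₁} {c D : ℝ}
    (hφc : ContinuousOn φ (Iic c)) (hφ : ∀ s, s ≤ c → ‖φ s‖ ≤ D * Real.exp (-b * s)) :
    IntegrableOn (fun s => S (c - s) (φ s)) (Iic c) ∧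
      ‖∫ s in Iic c, S (c - s) (φ s)‖ ≤ D / (a - b) * Real.exp (-b * c) := by
  have hab : 0 < a - b := sub_pos.2 hd.weight_lt
  have hint := (integrableOn_exp_mul_Iic (a := a - b) hab c).const_mul (D * Real.exp (-a * c))
  have hb : ∀ s ∈ Iic c, ‖S (c - s) (φ s)‖ ≤
      D * Real.exp (-a * c) * Real.exp ((a - b) * s) := by
    intro s hs
    have hs' : 0 ≤ c - s := sub_nonneg.2 hs
    calc ‖S (c - s) (φ s)‖ ≤ Real.exp (-a * (c - s)) * ‖φ s‖ := hd.norm_semigroup_le _ hs' _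
      _ ≤ Real.exp (-a * (c - s)) * (D * Real.exp (-b * s)) := by
        gcongr
        exact hφ s hs
      _ = D * (Real.exp (-a * (c - s)) * Real.exp (-b * s)) := by ring
      _ = D * (Real.exp (-a * c) * Real.exp ((a - b) * s)) := by
        rw [← Real.exp_add, ← Real.exp_add]
        congr 2
        ring
      _ = _ := by ring
  have hmeas : AEStronglyMeasurable (fun s => S (c - s) (φ s)) (volume.restrict (Iic c)) :=
    (hd.semigroup.continuousOn_conv hφc c).aestronglyMeasurable measurableSet_Iic
  refine ⟨hint.mono' hmeas (ae_restrict_of_forall_mem measurableSet_Iic hb), ?_⟩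
  have h := norm_integral_le_of_norm_le hint (ae_restrict_of_forall_mem measurableSet_Iic hb)
  rw [integral_const_mul, integral_exp_mul_Iic hab] at h
  refine h.trans (le_of_eq ?_)
  have : Real.exp (-b * c) = Real.exp (-a * c) * Real.exp ((a - b) * c) := by
    rw [← Real.exp_add]; congr 1; ring
  rw [this]
  ring

/-- Backward in time the group grows at most at rate `γ < b`, so the convolution keeps the weight
`exp (-b * c)` and costs a factor `1 / (b - γ)`. -/
theorem norm_integral_group_le (hd : IsDichotomy S U a b γ L₁ L₂) {φ : ℝ → H₂} {c D : ℝ}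
    (hc : c ≤ 0) (hφ : ∀ s ∈ Icc c 0, ‖φ s‖ ≤ D * Real.exp (-b * s)) :
    ‖∫ s in (0 : ℝ)..c, U (c - s) (φ s)‖ ≤ D / (b - γ) * Real.exp (-b * c) := by
  have hγb : 0 < b - γ := sub_pos.2 hd.lt_weight
  have hD : 0 ≤ D := by
    have := (norm_nonneg _).trans (hφ 0 (right_mem_Icc.2 hc))
    simpa using this
  rw [intervalIntegral.integral_symm, norm_neg]
  refine (norm_integral_le_exp_conv (φ := fun s => U (c - s) (φ s)) (c := c) (p := -γ) (q := -b)
    (D := D) hc (by linarith) fun s hs => ?_).trans ?_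
  · refine (hd.norm_group_le _ (by linarith [hs.1]) _).trans ?_
    rw [mul_left_comm]
    gcongr
    exact hφ s hs
  · have h1 : Real.exp (-b * c) = Real.exp (-γ * c) * Real.exp ((-b - -γ) * c) := by
      rw [← Real.exp_add]; congr 1; ring
    have h2 : (Real.exp ((-b - -γ) * 0) - Real.exp ((-b - -γ) * c)) / (-b - -γ) =
        (Real.exp ((-b - -γ) * c) - 1) / (b - γ) := by
      rw [mul_zero, Real.exp_zero, ← neg_div_neg_eq]
      congr 1 <;> ring
    rw [h1, h2]
    calc D * (Real.exp (-γ * c) * ((Real.exp ((-b - -γ) * c) - 1) / (b - γ)))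
        ≤ D * (Real.exp (-γ * c) * (Real.exp ((-b - -γ) * c) / (b - γ))) := by
          gcongr
          linarith
      _ = _ := by ring

theorem integral_Iic_split [CompleteSpace H₁] (hd : IsDichotomy S U a b γ L₁ L₂) {φ : ℝ → H₁}
    {τ t D : ℝ} (hτt : τ ≤ t) (hφc : ContinuousOn φ (Iic t))
    (hφ : ∀ s, s ≤ t → ‖φ s‖ ≤ D * Real.exp (-b * s)) :
    ∫ s in Iic t, S (t - s) (φ s) =
      S (t - τ) (∫ s in Iic τ, S (τ - s) (φ s)) + ∫ s in τ..t, S (t - s) (φ s) := by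
  have hsub : Iic τ ⊆ Iic t := Iic_subset_Iic.2 hτt
  have h1 := (hd.integrableOn_conv (hφc.mono hsub) fun s hs => hφ s (hs.trans hτt)).1
  have h2 := (hd.integrableOn_conv hφc hφ).1
  have h3 := intervalIntegral.integral_Iic_sub_Iic (h2.mono_set hsub) h2
  rw [← (S (t - τ)).integral_comp_comm h1, ← h3]
  have h4 : ∫ s in Iic τ, S (t - τ) (S (τ - s) (φ s)) = ∫ s in Iic τ, S (t - s) (φ s) := by
    refine setIntegral_congr_fun measurableSet_Iic fun s hs => ?_
    have hs' : 0 ≤ τ - s := sub_nonneg.2 hs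
    rw [hd.semigroup.apply_add (sub_nonneg.2 hτt) hs']
    congr 2
    ring
  rw [h4]
  abel

theorem group_apply (hd : IsDichotomy S U a b γ L₁ L₂) (s t : ℝ) (y : H₂) :
    U s (U t y) = U (s + t) y := by
  rw [hd.group_add]; rfl

end IsDichotomy

/-- The Lyapunov-Perron operator, frozen for positive times. -/
noncomputable def lyapunovPerron (S : ℝ → H₁ →L[ℝ] H₁) (U : ℝ → H₂ →L[ℝ] H₂)
    (F₁ : ℝ → H₁ × H₂ → H₁) (F₂ : ℝ → H₁ × H₂ → H₂) (ξ : H₂) (z : ℝ → H₁ × H₂) (t : ℝ) : H₁ × H₂ :=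
  (∫ s in Iic (min t 0), S (min t 0 - s) (F₁ s (z s)),
    U (min t 0) ξ + ∫ s in (0 : ℝ)..min t 0, U (min t 0 - s) (F₂ s (z s)))

variable {F₁ : ℝ → H₁ × H₂ → H₁} {F₂ : ℝ → H₁ × H₂ → H₂}

theorem sum_norm_le_two_mul {G₁ G₂ : Type*} [NormedAddCommGroup G₁] [NormedAddCommGroup G₂]
    (e : G₁ × G₂) : ‖e.1‖ + ‖e.2‖ ≤ 2 * ‖e‖ := by
  linarith [norm_fst_le e, norm_snd_le e]

theorem norm_le_sum_norm {G₁ G₂ : Type*} [NormedAddCommGroup G₁] [NormedAddCommGroup G₂]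
    (e : G₁ × G₂) : ‖e‖ ≤ ‖e.1‖ + ‖e.2‖ := by
  rw [Prod.norm_def]
  exact max_le (by linarith [norm_nonneg e.2]) (by linarith [norm_nonneg e.1])

theorem exists_weighted_bound {G₁ G₂ G : Type*} [NormedAddCommGroup G₁] [NormedAddCommGroup G₂]
    [NormedAddCommGroup G] {F : ℝ → G₁ × G₂ → G} {L b : ℝ} (hL : 0 ≤ L) (hF : ∀ s p q, ‖F s p - F s q‖ ≤ L * (‖(p - q).1‖ + ‖(p - q).2‖))
    (hF0 : ∃ C, ∀ s, s ≤ 0 → ‖F s 0‖ ≤ C * Real.exp (-b * s)) {z : ℝ → G₁ × G₂}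
    (hz : ∃ C, ∀ s, s ≤ 0 → ‖z s‖ ≤ C * Real.exp (-b * s)) :
    ∃ D, ∀ s, s ≤ 0 → ‖F s (z s)‖ ≤ D * Real.exp (-b * s) := by
  obtain ⟨C₀, hC₀⟩ := hF0
  obtain ⟨C, hC⟩ := hz
  refine ⟨L * (2 * C) + C₀, fun s hs => ?_⟩
  have h1 := hF s (z s) 0
  rw [sub_zero] at h1
  have h2 := norm_sub_norm_le (F s (z s)) (F s 0)
  have h3 : L * (‖(z s).1‖ + ‖(z s).2‖) ≤ L * (2 * (C * Real.exp (-b * s))) := by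
    gcongr
    linarith [sum_norm_le_two_mul (z s), hC s hs]
  have h4 := hC₀ s hs
  rw [add_mul]
  linarith

/-- The components are estimated separately because `‖ξ - ξ'‖` enters the second one only. The sum
yields the contraction; the first component alone yields the Lipschitz constant of the graph. -/
theorem norm_lyapunovPerron_sub_le (hd : IsDichotomy S U a b γ L₁ L₂)
    (hF : IsNonlinearity F₁ F₂ b L₁ L₂) (ξ ξ' : H₂) {z z' : ℝ → H₁ × H₂} (hzc : Continuous z)
    (hzc' : Continuous z') (hz : ∃ C, ∀ s, s ≤ 0 → ‖z s‖ ≤ C * Real.exp (-b * s))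
    (hz' : ∃ C, ∀ s, s ≤ 0 → ‖z' s‖ ≤ C * Real.exp (-b * s)) {C : ℝ}
    (hC : ∀ s, s ≤ 0 → ‖(z s - z' s).1‖ + ‖(z s - z' s).2‖ ≤ C * Real.exp (-b * s)) (t : ℝ) :
    ‖(lyapunovPerron S U F₁ F₂ ξ z t - lyapunovPerron S U F₁ F₂ ξ' z' t).1‖ ≤
      L₁ / (a - b) * C * Real.exp (-b * min t 0) ∧
    ‖(lyapunovPerron S U F₁ F₂ ξ z t - lyapunovPerron S U F₁ F₂ ξ' z' t).2‖ ≤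
      (L₂ / (b - γ) * C + ‖ξ - ξ'‖) * Real.exp (-b * min t 0) := by
  have hc : min t 0 ≤ 0 := min_le_right _ _
  set c := min t 0 with hcdef
  have hφ₁ : Continuous fun s => F₁ s (z s) := hF.continuous_left.comp (continuous_id.prodMk hzc)
  have hφ₂ : Continuous fun s => F₂ s (z s) := hF.continuous_right.comp (continuous_id.prodMk hzc)
  have hφ₁' : Continuous fun s => F₁ s (z' s) :=
    hF.continuous_left.comp (continuous_id.prodMk hzc')
  have hφ₂' : Continuous fun s => F₂ s (z' s) :=
    hF.continuous_right.comp (continuous_id.prodMk hzc')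
  obtain ⟨D, hD⟩ := exists_weighted_bound hd.nonneg_left hF.lipschitz_left hF.growth_left hz
  obtain ⟨D', hD'⟩ := exists_weighted_bound hd.nonneg_left hF.lipschitz_left hF.growth_left hz'
  constructor
  · have h1 := (hd.integrableOn_conv (c := c) hφ₁.continuousOn fun s hs => hD s (hs.trans hc)).1
    have h2 := (hd.integrableOn_conv (c := c) hφ₁'.continuousOn
      fun s hs => hD' s (hs.trans hc)).1
    have h3 := (hd.integrableOn_conv (c := c) (D := L₁ * C) (hφ₁.sub hφ₁').continuousOn
      fun s hs => by
        refine (hF.lipschitz_left s _ _).trans ?_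
        rw [mul_assoc]
        exact mul_le_mul_of_nonneg_left (hC s (hs.trans hc)) hd.nonneg_left).2
    simp only [Pi.sub_apply, map_sub] at h3
    rw [integral_sub h1 h2] at h3
    refine h3.trans (le_of_eq ?_)
    ring
  · have h1 := hd.group.intervalIntegrable_conv (a := 0) (b := c) hφ₂.continuousOn c
    have h2 := hd.group.intervalIntegrable_conv (a := 0) (b := c) hφ₂'.continuousOn c
    have h3 := hd.norm_integral_group_le (c := c) (D := L₂ * C)
      (φ := fun s => F₂ s (z s) - F₂ s (z' s)) hc
      fun s hs => by
        refine (hF.lipschitz_right s _ _).trans ?_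
        rw [mul_assoc]
        exact mul_le_mul_of_nonneg_left (hC s hs.2) hd.nonneg_right
    simp only [map_sub] at h3
    rw [intervalIntegral.integral_sub h1 h2] at h3
    have h4 := norm_add_le_of_le (hd.norm_group_le c hc (ξ - ξ')) h3
    have hγ : Real.exp (-γ * c) ≤ Real.exp (-b * c) :=
      Real.exp_le_exp.2 (by nlinarith [hd.lt_weight])
    have h5 : (lyapunovPerron S U F₁ F₂ ξ z t - lyapunovPerron S U F₁ F₂ ξ' z' t).2 =
        U c (ξ - ξ') + ((∫ s in (0 : ℝ)..c, U (c - s) (F₂ s (z s))) -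
          ∫ s in (0 : ℝ)..c, U (c - s) (F₂ s (z' s))) := by
      simp only [lyapunovPerron, Prod.snd_sub, map_sub, ← hcdef]
      abel
    rw [h5]
    refine h4.trans ?_
    have h6 := mul_le_mul_of_nonneg_right hγ (norm_nonneg (ξ - ξ'))
    have h7 : L₂ * C / (b - γ) = L₂ / (b - γ) * C := by ring
    rw [h7, add_mul]
    linarith

/-- Fixed points of the Lyapunov-Perron operator depend Lipschitz continuously on the parameter. -/
theorem sum_norm_fixedPoint_sub_le (hd : IsDichotomy S U a b γ L₁ L₂)
    (hF : IsNonlinearity F₁ F₂ b L₁ L₂) {ξ ξ' : H₂} {z z' : ℝ → H₁ × H₂} (hzc : Continuous z)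
    (hzc' : Continuous z') (hz : ∃ C, ∀ s, s ≤ 0 → ‖z s‖ ≤ C * Real.exp (-b * s))
    (hz' : ∃ C, ∀ s, s ≤ 0 → ‖z' s‖ ≤ C * Real.exp (-b * s))
    (hfix : lyapunovPerron S U F₁ F₂ ξ z = z) (hfix' : lyapunovPerron S U F₁ F₂ ξ' z' = z')
    {t : ℝ} (ht : t ≤ 0) :
    ‖(z t - z' t).1‖ + ‖(z t - z' t).2‖ ≤
      ‖ξ - ξ'‖ / (1 - (L₁ / (a - b) + L₂ / (b - γ))) * Real.exp (-b * t) := by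
  have h₁ : 0 ≤ L₁ / (a - b) := div_nonneg hd.nonneg_left (sub_pos.2 hd.weight_lt).le
  have h₂ : 0 ≤ L₂ / (b - γ) := div_nonneg hd.nonneg_right (sub_pos.2 hd.lt_weight).le
  refine le_of_forall_bound_imp (X := Iic (0 : ℝ))
    (N := fun s => ‖(z s - z' s).1‖ + ‖(z s - z' s).2‖) (w := fun s => Real.exp (-b * s))
    (add_nonneg h₁ h₂) hd.gap ?_ ?_ ⟨t, ht⟩
  · obtain ⟨C, hC⟩ := hz
    obtain ⟨C', hC'⟩ := hz'
    refine ⟨2 * (C + C'), fun s => ?_⟩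
    have h1 := sum_norm_le_two_mul (z s - z' s)
    have h2 := norm_sub_le (z s) (z' s)
    have h3 := hC s s.2
    have h4 := hC' s s.2
    linarith
  · intro C hC s
    have := norm_lyapunovPerron_sub_le hd hF ξ ξ' hzc hzc' hz hz' (fun r hr => hC ⟨r, hr⟩) s
    rw [hfix, hfix', min_eq_left s.2] at this
    linarith [this.1, this.2]

theorem measurable_iterate_lyapunovPerron [MeasurableSpace H₁] [BorelSpace H₁]
    [SecondCountableTopology H₁] [MeasurableSpace H₂] [BorelSpace H₂] [SecondCountableTopology H₂]
    (hS : IsContSemigroup S) (hU : IsContSemigroup U) {Θ : Type*} [MeasurableSpace Θ]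
    {F₁ : Θ → ℝ → H₁ × H₂ → H₁} {F₂ : Θ → ℝ → H₁ × H₂ → H₂}
    (hF₁ : Measurable fun q : Θ × ℝ × H₁ × H₂ => F₁ q.1 q.2.1 q.2.2)
    (hF₂ : Measurable fun q : Θ × ℝ × H₁ × H₂ => F₂ q.1 q.2.1 q.2.2) (ξ : H₂) (n : ℕ) :
    Measurable fun q : Θ × ℝ => (lyapunovPerron S U (F₁ q.1) (F₂ q.1) ξ)^[n] 0 q.2 := by
  have hSm : Measurable fun p : ℝ × H₁ => S p.1 p.2 := hS.continuous.measurable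
  have hUm : Measurable fun p : ℝ × H₂ => U p.1 p.2 := hU.continuous.measurable
  induction n with
  | zero => exact measurable_const
  | succ n ih =>
    simp only [Function.iterate_succ_apply']
    set Z := fun q : Θ × ℝ => (lyapunovPerron S U (F₁ q.1) (F₂ q.1) ξ)^[n] 0 q.2 with hZ
    have hZ' : Measurable fun p : (Θ × ℝ) × ℝ => (p.1.1, p.2, Z (p.1.1, p.2)) := by fun_prop
    refine Measurable.prodMk ?_ (Measurable.add ?_ ?_)
    · have h : Measurable fun p : (Θ × ℝ) × ℝ =>
          S (min p.1.2 0 - p.2) (F₁ p.1.1 p.2 (Z (p.1.1, p.2))) :=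
        hSm.comp (f := fun p : (Θ × ℝ) × ℝ =>
          (min p.1.2 0 - p.2, F₁ p.1.1 p.2 (Z (p.1.1, p.2))))
          (Measurable.prodMk (by fun_prop) (hF₁.comp hZ'))
      have hset : MeasurableSet {p : (Θ × ℝ) × ℝ | p.2 ≤ min p.1.2 0} :=
        measurableSet_le measurable_snd (by fun_prop)
      have h3 := ((h.indicator hset).stronglyMeasurable.integral_prod_right'
        (ν := (volume : Measure ℝ))).measurable
      convert h3 using 2 with q
      rw [← integral_indicator measurableSet_Iic]
      rfl
    · exact hUm.comp (f := fun q : Θ × ℝ => (min q.2 0, ξ)) (by fun_prop)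
    · have h : Measurable fun p : (Θ × ℝ) × ℝ =>
          U (min p.1.2 0 - p.2) (F₂ p.1.1 p.2 (Z (p.1.1, p.2))) :=
        hUm.comp (f := fun p : (Θ × ℝ) × ℝ =>
          (min p.1.2 0 - p.2, F₂ p.1.1 p.2 (Z (p.1.1, p.2))))
          (Measurable.prodMk (by fun_prop) (hF₂.comp hZ'))
      have hset : MeasurableSet {p : (Θ × ℝ) × ℝ | min p.1.2 0 < p.2 ∧ p.2 ≤ 0} :=
        (measurableSet_lt (by fun_prop) measurable_snd).inter
          (measurableSet_le measurable_snd measurable_const)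
      have h3 := ((h.indicator hset).stronglyMeasurable.integral_prod_right'
        (ν := (volume : Measure ℝ))).measurable.neg
      convert h3 using 2 with q
      rw [intervalIntegral.integral_of_ge (min_le_right _ _),
        ← integral_indicator measurableSet_Ioc]
      rfl

section

variable [CompleteSpace H₁]

theorem continuous_lyapunovPerron (hd : IsDichotomy S U a b γ L₁ L₂)
    (hF : IsNonlinearity F₁ F₂ b L₁ L₂) (ξ : H₂) {z : ℝ → H₁ × H₂} (hzc : Continuous z)
    (hz : ∃ C, ∀ s, s ≤ 0 → ‖z s‖ ≤ C * Real.exp (-b * s)) :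
    Continuous (lyapunovPerron S U F₁ F₂ ξ z) := by
  have hφ₁ : Continuous fun s => F₁ s (z s) := hF.continuous_left.comp (continuous_id.prodMk hzc)
  have hφ₂ : Continuous fun s => F₂ s (z s) := hF.continuous_right.comp (continuous_id.prodMk hzc)
  obtain ⟨D, hD⟩ := exists_weighted_bound hd.nonneg_left hF.lipschitz_left hF.growth_left hz
  refine Continuous.prodMk ?_ (Continuous.add ?_ ?_)
  · rw [continuous_iff_continuousAt]
    intro t₀
    -- Below the fixed time `τ` the half-line integral is one constant vector carried by the
    -- semigroup; the dependence on `t` near `t₀` is left to a compact interval.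
    set τ := min t₀ 0 - 1 with hτ
    have hc : Continuous fun t : ℝ => S (min t 0 - τ) (∫ s in Iic τ, S (τ - s) (F₁ s (z s))) +
        ∫ s in τ..min t 0, S (min t 0 - s) (F₁ s (z s)) := by
      refine Continuous.add ?_ ?_
      · exact hd.semigroup.continuous.comp
          (f := fun t : ℝ => (min t 0 - τ, ∫ s in Iic τ, S (τ - s) (F₁ s (z s)))) (by fun_prop)
      · refine intervalIntegral.continuous_parametric_intervalIntegral_of_continuous
          (f := fun t s => S (min t 0 - s) (F₁ s (z s))) ?_ (by fun_prop)
        exact hd.semigroup.continuous.comp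
          (f := fun p : ℝ × ℝ => (min p.1 0 - p.2, F₁ p.2 (z p.2)))
          (Continuous.prodMk (by fun_prop) (hφ₁.comp continuous_snd))
    refine hc.continuousAt.congr ?_
    have hev : ∀ᶠ t in 𝓝 t₀, τ < min t 0 :=
      (Continuous.tendsto (f := fun t : ℝ => min t 0) (by fun_prop) t₀).eventually_const_lt
        (sub_one_lt (min t₀ 0))
    filter_upwards [hev] with t ht
    exact (hd.integral_Iic_split ht.le hφ₁.continuousOn
      fun s hs => hD s (hs.trans (min_le_right _ _))).symm
  · exact hd.group.continuous.comp (f := fun t : ℝ => (min t 0, ξ)) (by fun_prop)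
  · refine intervalIntegral.continuous_parametric_intervalIntegral_of_continuous
      (f := fun t s => U (min t 0 - s) (F₂ s (z s))) ?_ (by fun_prop)
    exact hd.group.continuous.comp
      (f := fun p : ℝ × ℝ => (min p.1 0 - p.2, F₂ p.2 (z p.2)))
        (Continuous.prodMk (by fun_prop) (hφ₂.comp continuous_snd))

variable [CompleteSpace H₂]

theorem exists_fixedPoint_lyapunovPerron (hd : IsDichotomy S U a b γ L₁ L₂)
    (hF : IsNonlinearity F₁ F₂ b L₁ L₂) (ξ : H₂) :
    ∃ z, Continuous z ∧ (∃ C, ∀ s, s ≤ 0 → ‖z s‖ ≤ C * Real.exp (-b * s)) ∧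
      lyapunovPerron S U F₁ F₂ ξ z = z ∧
      ∀ t, Tendsto (fun n => (lyapunovPerron S U F₁ F₂ ξ)^[n] 0 t) atTop (𝓝 (z t)) := by
  have h₁ : 0 ≤ L₁ / (a - b) := div_nonneg hd.nonneg_left (sub_pos.2 hd.weight_lt).le
  have h₂ : 0 ≤ L₂ / (b - γ) := div_nonneg hd.nonneg_right (sub_pos.2 hd.lt_weight).le
  have hres : ∀ {z : ℝ → H₁ × H₂}, (∃ C, ∀ t, ‖z t‖ ≤ C * Real.exp (-b * min t 0)) →
      ∃ C, ∀ t, t ≤ 0 → ‖z t‖ ≤ C * Real.exp (-b * t) := fun ⟨C, hC⟩ =>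
    ⟨C, fun t ht => by simpa [min_eq_left ht] using hC t⟩
  obtain ⟨z, hzc, hzb, hfix, hlim⟩ := exists_fixedPoint_of_weighted_contraction
    (N := fun e : H₁ × H₂ => ‖e.1‖ + ‖e.2‖) norm_le_sum_norm sum_norm_le_two_mul
    (w := fun t => Real.exp (-b * min t 0)) (by fun_prop) (fun _ => Real.exp_pos _)
    (add_nonneg h₁ h₂) hd.gap (lyapunovPerron S U F₁ F₂ ξ)
    (fun z hzc hz => continuous_lyapunovPerron hd hF ξ hzc (hres hz))
    (by
      obtain ⟨D, hD⟩ := hF.growth_left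
      obtain ⟨D', hD'⟩ := hF.growth_right
      refine ⟨D / (a - b) + (‖ξ‖ + D' / (b - γ)), fun t => ?_⟩
      have hc : min t 0 ≤ 0 := min_le_right _ _
      have h0 : Continuous fun s => F₁ s 0 :=
        hF.continuous_left.comp (f := fun s : ℝ => (s, (0 : H₁ × H₂))) (by fun_prop)
      refine (norm_le_sum_norm _).trans ?_
      rw [add_mul, add_mul]
      have hγ : Real.exp (-γ * min t 0) ≤ Real.exp (-b * min t 0) :=
        Real.exp_le_exp.2 (by nlinarith [hd.lt_weight])
      refine add_le_add ?_ (norm_add_le_of_le ?_ ?_)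
      · exact (hd.integrableOn_conv h0.continuousOn fun s hs => hD s (hs.trans hc)).2
      · refine (hd.norm_group_le _ hc ξ).trans ?_
        rw [mul_comm]
        gcongr
      · exact hd.norm_integral_group_le (φ := fun s => F₂ s 0) hc fun s hs => hD' s hs.2)
    (fun z z' hzc hzc' hz hz' C hC t => by
      have := norm_lyapunovPerron_sub_le hd hF ξ ξ hzc hzc' (hres hz) (hres hz') (C := C)
        (fun r hr => by simpa [min_eq_left hr] using hC r) t
      rw [sub_self, norm_zero, add_zero] at this
      refine (add_le_add this.1 this.2).trans (le_of_eq ?_)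
      ring)
  exact ⟨z, hzc, hres hzb, hfix, hlim⟩

/-- The backward mild solutions of the coupled system, in the weighted space. -/
structure IsWeightedBackwardSolution (S : ℝ → H₁ →L[ℝ] H₁) (U : ℝ → H₂ →L[ℝ] H₂)
    (F₁ : ℝ → H₁ × H₂ → H₁) (F₂ : ℝ → H₁ × H₂ → H₂) (b : ℝ) (z : ℝ → H₁ × H₂) : Prop where
  continuousOn : ContinuousOn z (Iic 0)
  bound : ∃ C, ∀ s, s ≤ 0 → ‖z s‖ ≤ C * Real.exp (-b * s)
  left : ∀ τ t, τ ≤ t → t ≤ 0 →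
    (z t).1 = S (t - τ) (z τ).1 + ∫ s in τ..t, S (t - s) (F₁ s (z s))
  right : ∀ τ t, τ ≤ t → t ≤ 0 →
    (z t).2 = U (t - τ) (z τ).2 + ∫ s in τ..t, U (t - s) (F₂ s (z s))

theorem isWeightedBackwardSolution_of_fixedPoint (hd : IsDichotomy S U a b γ L₁ L₂)
    (hF : IsNonlinearity F₁ F₂ b L₁ L₂) {ξ : H₂} {z : ℝ → H₁ × H₂} (hzc : Continuous z)
    (hz : ∃ C, ∀ s, s ≤ 0 → ‖z s‖ ≤ C * Real.exp (-b * s))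
    (hfix : lyapunovPerron S U F₁ F₂ ξ z = z) :
    IsWeightedBackwardSolution S U F₁ F₂ b z := by
  have hφ₁ : Continuous fun s => F₁ s (z s) := hF.continuous_left.comp (continuous_id.prodMk hzc)
  have hφ₂ : Continuous fun s => F₂ s (z s) := hF.continuous_right.comp (continuous_id.prodMk hzc)
  obtain ⟨D, hD⟩ := exists_weighted_bound hd.nonneg_left hF.lipschitz_left hF.growth_left hz
  have hx : ∀ t, t ≤ 0 → (z t).1 = ∫ s in Iic t, S (t - s) (F₁ s (z s)) := by
    intro t ht
    conv_lhs => rw [← hfix]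
    simp only [lyapunovPerron, min_eq_left ht]
  have hy : ∀ t, t ≤ 0 → (z t).2 = U t ξ + ∫ s in (0 : ℝ)..t, U (t - s) (F₂ s (z s)) := by
    intro t ht
    conv_lhs => rw [← hfix]
    simp only [lyapunovPerron, min_eq_left ht]
  refine ⟨hzc.continuousOn, hz, fun τ t hτt ht => ?_, fun τ t hτt ht => ?_⟩
  · rw [hx t ht, hx τ (hτt.trans ht)]
    exact hd.integral_Iic_split hτt hφ₁.continuousOn fun s hs => hD s (hs.trans ht)
  · rw [hy t ht, hy τ (hτt.trans ht), map_add, hd.group_apply, sub_add_cancel,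
      hd.group.map_integral_conv (t := t) hφ₂.continuousOn (U (t - τ)) fun s _ => by
        rw [← hd.group_add]; congr 1; ring,
      add_assoc, intervalIntegral.integral_add_adjacent_intervals
        (hd.group.intervalIntegrable_conv hφ₂.continuousOn t)
        (hd.group.intervalIntegrable_conv hφ₂.continuousOn t)]

/-- Growth at rate `b < a` forces the `x`-component to equal the integral over the whole past.
Freezing at positive times is assumed because the operator produces only frozen functions. -/
theorem IsWeightedBackwardSolution.fixedPoint (hd : IsDichotomy S U a b γ L₁ L₂)
    (hF : IsNonlinearity F₁ F₂ b L₁ L₂) {z : ℝ → H₁ × H₂}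
    (hz : IsWeightedBackwardSolution S U F₁ F₂ b z) (hconst : ∀ t, z t = z (min t 0)) :
    lyapunovPerron S U F₁ F₂ (z 0).2 z = z := by
  have hφ₁ : ContinuousOn (fun s => F₁ s (z s)) (Iic 0) :=
    continuousOn_comp_uncurry hF.continuous_left hz.continuousOn
  have hφ₂ : ContinuousOn (fun s => F₂ s (z s)) (Iic 0) :=
    continuousOn_comp_uncurry hF.continuous_right hz.continuousOn
  obtain ⟨D, hD⟩ := exists_weighted_bound hd.nonneg_left hF.lipschitz_left hF.growth_left hz.bound
  funext t
  rw [hconst t]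
  have ht : min t 0 ≤ 0 := min_le_right _ _
  unfold lyapunovPerron
  generalize min t 0 = c at ht
  refine Prod.ext ?_ ?_
  · simp only
    set X : ℝ → H₁ := fun t => ∫ s in Iic t, S (t - s) (F₁ s (z s)) with hX
    obtain ⟨C, hC⟩ := hz.bound
    have hab : 0 < a - b := sub_pos.2 hd.weight_lt
    -- `X` and the `x`-component solve the same equation, so their difference at `c` is `S (c - τ)`
    -- applied to the difference at `τ`. Its bound is a multiple of `exp ((a - b) * τ)`, which
    -- vanishes as `τ → -∞`.
    have hb : ∀ τ ∈ Iic c, ‖X c - (z c).1‖ ≤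
        (D / (a - b) + C) * Real.exp (-a * c) * Real.exp ((a - b) * τ) := by
      intro τ hτ
      have hτ0 : τ ≤ 0 := le_trans hτ ht
      have h1 : X c - (z c).1 = S (c - τ) (X τ - (z τ).1) := by
        rw [hz.left τ c hτ ht, map_sub, hX]
        simp only
        rw [hd.integral_Iic_split hτ (hφ₁.mono (Iic_subset_Iic.2 ht))
          fun s hs => hD s (hs.trans ht)]
        abel
      have h2 : ‖X τ‖ ≤ D / (a - b) * Real.exp (-b * τ) :=
        (hd.integrableOn_conv (hφ₁.mono (Iic_subset_Iic.2 hτ0)) fun s hs => hD s (hs.trans hτ0)).2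
      have h3 := (norm_fst_le (z τ)).trans (hC τ hτ0)
      rw [h1]
      calc _ ≤ Real.exp (-a * (c - τ)) * ‖X τ - (z τ).1‖ :=
            hd.norm_semigroup_le _ (sub_nonneg.2 hτ) _
        _ ≤ Real.exp (-a * (c - τ)) * ((D / (a - b) + C) * Real.exp (-b * τ)) := by
            gcongr
            rw [add_mul]
            exact norm_sub_le_of_le h2 h3
        _ = (D / (a - b) + C) * (Real.exp (-a * (c - τ)) * Real.exp (-b * τ)) := by ring
        _ = (D / (a - b) + C) * (Real.exp (-a * c) * Real.exp ((a - b) * τ)) := by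
            rw [← Real.exp_add, ← Real.exp_add]
            congr 2
            ring
        _ = _ := by ring
    have hlim : Tendsto (fun τ => (D / (a - b) + C) * Real.exp (-a * c) * Real.exp ((a - b) * τ))
        atBot (𝓝 ((D / (a - b) + C) * Real.exp (-a * c) * 0)) :=
      (Real.tendsto_exp_atBot.comp (tendsto_id.const_mul_atBot hab)).const_mul _
    rw [mul_zero] at hlim
    have h0 : ‖X c - (z c).1‖ ≤ 0 :=
      ge_of_tendsto hlim ((eventually_le_atBot c).mono hb)
    exact sub_eq_zero.1 (norm_le_zero_iff.1 h0)
  · simp only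
    -- The equation on `[c, 0]` expresses `y(0)` through `y(c)`; applying `U c`, the inverse of `U
    -- (0 - c)`, turns it around.
    have h1 := hz.right c 0 ht le_rfl
    have hφ : ContinuousOn (fun s => F₂ s (z s)) (uIcc c 0) :=
      hφ₂.mono (by rw [uIcc_of_le ht]; exact fun s hs => hs.2)
    rw [h1, map_add, hd.group_apply, add_sub_cancel, hd.group.map_zero,
      hd.group.map_integral_conv (t := c) hφ (U c) fun s _ => by
        rw [← hd.group_add]; congr 1; ring,
      intervalIntegral.integral_symm c 0]
    simp

/-- The set of the values at time `0` of the weighted backward solutions is a Lipschitz graph,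
measurable in the parameter. -/
theorem exists_measurable_graph [MeasurableSpace H₁] [BorelSpace H₁]
    [SecondCountableTopology H₁] [MeasurableSpace H₂] [BorelSpace H₂] [SecondCountableTopology H₂]
    (hd : IsDichotomy S U a b γ L₁ L₂) {Θ : Type*} [MeasurableSpace Θ]
    {F₁ : Θ → ℝ → H₁ × H₂ → H₁} {F₂ : Θ → ℝ → H₁ × H₂ → H₂}
    (hF : ∀ θ, IsNonlinearity (F₁ θ) (F₂ θ) b L₁ L₂)
    (hF₁ : Measurable fun q : Θ × ℝ × H₁ × H₂ => F₁ q.1 q.2.1 q.2.2)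
    (hF₂ : Measurable fun q : Θ × ℝ × H₁ × H₂ => F₂ q.1 q.2.1 q.2.2) :
    ∃ h : Θ → H₂ → H₁,
      (∀ θ ζ, (∃ z, IsWeightedBackwardSolution S U (F₁ θ) (F₂ θ) b z ∧ z 0 = ζ) ↔
        ζ.1 = h θ ζ.2) ∧
      (∀ θ ξ ξ', ‖h θ ξ - h θ ξ'‖ ≤
        L₁ / (a - b) * (‖ξ - ξ'‖ / (1 - (L₁ / (a - b) + L₂ / (b - γ))))) ∧
      ∀ ξ, Measurable fun θ => h θ ξ := by
  choose Z hZc hZb hZfix hZlim using fun θ ξ => exists_fixedPoint_lyapunovPerron hd (hF θ) ξ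
  have hZ0 : ∀ θ ξ, (Z θ ξ 0).2 = ξ := by
    intro θ ξ
    rw [← hZfix θ ξ]
    simp [lyapunovPerron, hd.group.map_zero]
  refine ⟨fun θ ξ => (Z θ ξ 0).1, fun θ ζ => ⟨?_, fun h => ?_⟩, fun θ ξ ξ' => ?_, fun ξ => ?_⟩
  · rintro ⟨z, hz, rfl⟩
    have hmin : ∀ {s : ℝ}, s ≤ 0 → z (min s 0) = z s := fun hs => by rw [min_eq_left hs]
    have hint : ∀ {τ t : ℝ}, τ ≤ t → t ≤ 0 → ∀ s ∈ uIcc τ t, z (min s 0) = z s := by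
      intro τ t hτt ht s hs
      rw [uIcc_of_le hτt] at hs
      exact hmin (hs.2.trans ht)
    -- Values at positive times are arbitrary, so the solution is replaced by its frozen version
    -- before uniqueness is applied.
    have hz' : IsWeightedBackwardSolution S U (F₁ θ) (F₂ θ) b fun t => z (min t 0) := by
      refine ⟨?_, ?_, fun τ t hτt ht => ?_, fun τ t hτt ht => ?_⟩
      · exact hz.continuousOn.congr fun s hs => hmin hs
      · obtain ⟨C, hC⟩ := hz.bound
        exact ⟨C, fun s hs => by rw [hmin hs]; exact hC s hs⟩
      · rw [hmin ht, hmin (hτt.trans ht), hz.left τ t hτt ht]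
        congr 1
        exact intervalIntegral.integral_congr fun s hs => by simp only [hint hτt ht s hs]
      · rw [hmin ht, hmin (hτt.trans ht), hz.right τ t hτt ht]
        congr 1
        exact intervalIntegral.integral_congr fun s hs => by simp only [hint hτt ht s hs]
    have hc : Continuous fun t => z (min t 0) :=
      hz.continuousOn.comp_continuous (by fun_prop) fun t => min_le_right t 0
    have hfix := hz'.fixedPoint hd (hF θ) (fun t => by simp)
    have := sum_norm_fixedPoint_sub_le hd (hF θ) hc (hZc θ (z 0).2) hz'.bound (hZb θ _)
      (ξ := (z 0).2) (by simpa using hfix) (hZfix θ _) (t := 0) le_rfl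
    rw [sub_self, norm_zero, zero_div, zero_mul] at this
    have h0 : ‖(z 0 - Z θ (z 0).2 0).1‖ ≤ 0 := by
      simp only [min_self] at this
      linarith [norm_nonneg (z 0 - Z θ (z 0).2 0).2]
    exact sub_eq_zero.1 (norm_le_zero_iff.1 h0)
  · exact ⟨Z θ ζ.2, isWeightedBackwardSolution_of_fixedPoint hd (hF θ) (hZc θ _) (hZb θ _)
      (hZfix θ _), Prod.ext h.symm (hZ0 θ _)⟩
  -- The weighted bound for the difference of two fixed points is fed once more into the first
  -- component, at time `0` where the weight is `1`.
  · have h1 := (norm_lyapunovPerron_sub_le hd (hF θ) ξ ξ' (hZc θ ξ) (hZc θ ξ') (hZb θ ξ) (hZb θ ξ')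
      (fun s hs => sum_norm_fixedPoint_sub_le hd (hF θ) (hZc θ ξ) (hZc θ ξ') (hZb θ ξ) (hZb θ ξ')
        (hZfix θ ξ) (hZfix θ ξ') hs) 0).1
    rw [hZfix, hZfix] at h1
    simpa using h1
  · have hm : Measurable fun q : Θ × ℝ => Z q.1 ξ q.2 :=
      measurable_of_tendsto_metrizable
        (fun n => measurable_iterate_lyapunovPerron hd.semigroup hd.group hF₁ hF₂ ξ n)
        (tendsto_pi_nhds.2 fun q => hZlim q.1 ξ q.2)
    exact (hm.comp (measurable_prodMk_right (y := (0 : ℝ)))).fst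

end

end Backward

/-! ### Joint continuity of C₀-semigroups and C₀-groups -/

section Semigroups

variable {E : Type*} [NormedAddCommGroup E] [NormedSpace ℝ E] [CompleteSpace E]

/-- A contraction semigroup, frozen for negative times, is jointly continuous. -/
theorem IsC0Semigroup.isContSemigroup {S : ℝ → E →L[ℝ] E} (hS : IsC0Semigroup S)
    (hc : ∀ t, 0 ≤ t → ∀ x, ‖S t x‖ ≤ ‖x‖) : IsContSemigroup fun t => S (max t 0) where
  map_zero := by rw [max_self, hS.map_zero]
  map_add s t hs ht := by
    rw [max_eq_left hs, max_eq_left ht, max_eq_left (add_nonneg hs ht), hS.map_add s t hs ht]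
  continuous := by
    refine continuous_uncurry_of_strongly_continuous (V := fun t => S (max t 0)) fun x => ?_
    have h0 : S 0 x = x := by rw [hS.map_zero]; rfl
    have h1 : Tendsto (fun r => ‖S |r| x - x‖) (𝓝 0) (𝓝 0) := by
      have h2 : Tendsto (fun r => S r x) (𝓝[≥] 0) (𝓝 x) := by
        have := (continuousWithinAt_Ioi_iff_Ici (f := fun r => S r x) (a := (0 : ℝ))).1
          (by simpa only [ContinuousWithinAt, h0] using hS.tendsto_zero x)
        simpa only [ContinuousWithinAt, h0] using this
      have h3 : Tendsto (fun r : ℝ => |r|) (𝓝 0) (𝓝[≥] 0) := by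
        refine tendsto_nhdsWithin_iff.2 ⟨?_, Eventually.of_forall fun r => abs_nonneg r⟩
        simpa using (continuous_abs (G := ℝ)).tendsto 0
      exact tendsto_iff_norm_sub_tendsto_zero.1 (h2.comp h3)
    -- Contractivity of `S s` reduces continuity at any time to continuity at `0`.
    have hdiff : ∀ s t, 0 ≤ s → s ≤ t → ‖S t x - S s x‖ ≤ ‖S |t - s| x - x‖ := by
      intro s t hs hst
      have h2 : S t x = S s (S (t - s) x) := by
        have := hS.map_add s (t - s) hs (sub_nonneg.2 hst)
        rw [add_sub_cancel] at this
        rw [this]; rfl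
      rw [h2, ← map_sub, abs_of_nonneg (sub_nonneg.2 hst)]
      exact hc s hs _
    have hdiff' : ∀ s t, 0 ≤ s → 0 ≤ t → ‖S t x - S s x‖ ≤ ‖S |t - s| x - x‖ := by
      intro s t hs ht
      rcases le_total s t with h | h
      · exact hdiff s t hs h
      · rw [norm_sub_rev, abs_sub_comm]
        exact hdiff t s ht h
    rw [continuous_iff_continuousAt]
    intro t₀
    rw [ContinuousAt, tendsto_iff_norm_sub_tendsto_zero]
    have h4 : Tendsto (fun t : ℝ => max t 0 - max t₀ 0) (𝓝 t₀) (𝓝 0) := by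
      have := Continuous.tendsto (f := fun t : ℝ => max t 0 - max t₀ 0) (by fun_prop) t₀
      simpa using this
    exact squeeze_zero (fun _ => norm_nonneg _)
      (fun t => hdiff' _ _ (le_max_right _ _) (le_max_right _ _)) (h1.comp h4)

theorem IsC0Group.isContSemigroup {U : ℝ → E →L[ℝ] E} (hU : IsC0Group U) : IsContSemigroup U where
  map_zero := hU.map_zero
  map_add s t _ _ := hU.map_add s t
  continuous := by
    refine continuous_uncurry_of_strongly_continuous fun x => ?_
    rw [continuous_iff_continuousAt]
    intro t₀
    have h1 : Tendsto (fun t : ℝ => t - t₀) (𝓝 t₀) (𝓝 0) := by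
      have := Continuous.tendsto (f := fun t : ℝ => t - t₀) (by fun_prop) t₀
      simpa using this
    refine (((U t₀).continuous.tendsto x).comp ((hU.tendsto_zero x).comp h1)).congr fun t => ?_
    simp only [Function.comp_apply]
    rw [← ContinuousLinearMap.comp_apply, ← hU.map_add, add_sub_cancel]

end Semigroups

/-! ### The coupled system as one equation on the product space -/

section Bridge

variable {H₁ H₂ : Type*} [NormedAddCommGroup H₁] [NormedSpace ℝ H₁] [CompleteSpace H₁]
  [NormedAddCommGroup H₂] [NormedSpace ℝ H₂] [CompleteSpace H₂]
  {S : ℝ → H₁ →L[ℝ] H₁} {U : ℝ → H₂ →L[ℝ] H₂}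
  {F₁ : ℝ → H₁ × H₂ → H₁} {F₂ : ℝ → H₁ × H₂ → H₂}

theorem mild_prodMap_iff (hS : IsContSemigroup S) (hU : IsContSemigroup U)
    (hF₁ : Continuous (Function.uncurry F₁)) (hF₂ : Continuous (Function.uncurry F₂))
    {z : ℝ → H₁ × H₂} {τ t : ℝ} (hτt : τ ≤ t) (hz : ContinuousOn z (Icc τ t)) :
    Mild (fun t => (S t).prodMap (U t)) (fun s p => (F₁ s p, F₂ s p)) z τ t ↔
      (z t).1 = S (t - τ) (z τ).1 + (∫ s in τ..t, S (t - s) (F₁ s (z s))) ∧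
      (z t).2 = U (t - τ) (z τ).2 + ∫ s in τ..t, U (t - s) (F₂ s (z s)) := by
  rw [← uIcc_of_le hτt] at hz
  have hφ : ContinuousOn (fun s => (F₁ s (z s), F₂ s (z s))) (uIcc τ t) :=
    (continuousOn_comp_uncurry hF₁ hz).prodMk (continuousOn_comp_uncurry hF₂ hz)
  have hint := (hS.prodMap hU).intervalIntegrable_conv hφ t
  have h1 := ContinuousLinearMap.intervalIntegral_comp_comm (ContinuousLinearMap.fst ℝ H₁ H₂) hint
  have h2 := ContinuousLinearMap.intervalIntegral_comp_comm (ContinuousLinearMap.snd ℝ H₁ H₂) hint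
  simp only [ContinuousLinearMap.coe_fst', ContinuousLinearMap.coe_snd'] at h1 h2
  unfold Mild
  simp only [Prod.ext_iff, Prod.fst_add, Prod.snd_add, ← h1, ← h2]
  rfl

theorem isWeightedBackwardSolution_iff_mild (hS : IsContSemigroup S) (hU : IsContSemigroup U)
    (hF₁ : Continuous (Function.uncurry F₁)) (hF₂ : Continuous (Function.uncurry F₂)) {b : ℝ}
    {z : ℝ → H₁ × H₂} :
    IsWeightedBackwardSolution S U F₁ F₂ b z ↔ ContinuousOn z (Iic 0) ∧
      (∃ C, ∀ s, s ≤ 0 → ‖z s‖ ≤ C * Real.exp (-b * s)) ∧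
      ∀ τ t, τ ≤ t → t ≤ 0 →
        Mild (fun t => (S t).prodMap (U t)) (fun s p => (F₁ s p, F₂ s p)) z τ t := by
  have hsub : ∀ {τ t : ℝ}, t ≤ 0 → Icc τ t ⊆ Iic 0 := fun ht s hs => hs.2.trans ht
  constructor
  · intro h
    exact ⟨h.continuousOn, h.bound, fun τ t hτt ht =>
      (mild_prodMap_iff hS hU hF₁ hF₂ hτt (h.continuousOn.mono (hsub ht))).2
        ⟨h.left τ t hτt ht, h.right τ t hτt ht⟩⟩
  · rintro ⟨hc, hb, hm⟩
    have := fun τ t hτt ht => (mild_prodMap_iff hS hU hF₁ hF₂ hτt (hc.mono (hsub ht))).1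
      (hm τ t hτt ht)
    exact ⟨hc, hb, fun τ t hτt ht => (this τ t hτt ht).1, fun τ t hτt ht => (this τ t hτt ht).2⟩

end Bridge

/-! ### Gluing backward and forward solutions -/

section Continuation

variable {E : Type*} [NormedAddCommGroup E] [NormedSpace ℝ E] [CompleteSpace E]
  {V : ℝ → E →L[ℝ] E} {F : ℝ → E → E}

/-- A backward solution, continued by a forward solution and shifted in time, is a backward
solution of the shifted equation. -/
theorem exists_backward_continuation (hV : IsContSemigroup V)
    (hF : Continuous (Function.uncurry F)) {z Z : ℝ → E} (hz : ContinuousOn z (Iic 0))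
    {b : ℝ} (hb : 0 ≤ b) (hzb : ∃ C, ∀ s, s ≤ 0 → ‖z s‖ ≤ C * Real.exp (-b * s))
    (hzm : ∀ τ t, τ ≤ t → t ≤ 0 → Mild V F z τ t) (hZ : Continuous Z) (hzZ : z 0 = Z 0)
    (hZm : ∀ t, 0 ≤ t → Mild V F Z 0 t) {t : ℝ} (ht : 0 ≤ t) :
    ∃ y : ℝ → E, y 0 = Z t ∧ ContinuousOn y (Iic 0) ∧
      (∃ C, ∀ s, s ≤ 0 → ‖y s‖ ≤ C * Real.exp (-b * s)) ∧
      ∀ τ r, τ ≤ r → r ≤ 0 → Mild V (fun s => F (t + s)) y τ r := by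
  -- This formula equals `z` for `s ≤ 0` and `Z` for `s ≥ 0`, and its continuity needs no case
  -- distinction.
  set x : ℝ → E := fun s => z (min s 0) + Z (max s 0) - Z 0 with hx
  have hxc : Continuous x := by
    have h1 : Continuous fun s => z (min s 0) :=
      hz.comp_continuous (by fun_prop) fun s => min_le_right s 0
    exact (h1.add (hZ.comp (by fun_prop))).sub continuous_const
  have hxz : ∀ s, s ≤ 0 → z s = x s := fun s hs => by
    simp [hx, min_eq_left hs, max_eq_right hs]
  have hxZ : ∀ s, 0 ≤ s → Z s = x s := fun s hs => by
    simp [hx, min_eq_right hs, max_eq_left hs, hzZ]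
  have hx0 : ∀ s, 0 ≤ s → Mild V F x 0 s := fun s hs =>
    (hZm s hs).congr hs fun r hr => hxZ r hr.1
  have hxm : ∀ τ s, τ ≤ s → Mild V F x τ s := by
    intro τ s hτs
    rcases le_total s 0 with hs | hs
    · exact (hzm τ s hτs hs).congr hτs fun r hr => hxz r (hr.2.trans hs)
    rcases le_total τ 0 with hτ | hτ
    · exact ((((hzm τ 0 hτ le_rfl).congr hτ fun r hr => hxz r hr.2).iff_of_left hV hF hτ hs
        hxc.continuousOn).1 (hx0 s hs))
    · exact ((hx0 τ hτ).iff_of_left hV hF hτ hτs hxc.continuousOn).2 (hx0 s hs)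
  refine ⟨fun s => x (t + s), by simp [hxZ t ht],
    (hxc.comp (continuous_const_add t)).continuousOn, ?_,
    fun τ r hτr _ => Mild.comp_add.2 (hxm _ _ (by linarith))⟩
  obtain ⟨C, hC⟩ := hzb
  obtain ⟨D, hD⟩ := (isCompact_Icc (a := 0) (b := t)).exists_bound_of_continuousOn hxc.continuousOn
  -- `|C|` covers the times with `t + s ≤ 0`, where the shift only improves the weight since `b * t
  -- ≥ 0`; `|D|` covers the compact piece `[0, t]`, where the weight is at least `1`.
  refine ⟨|C| + |D|, fun s hs => ?_⟩
  have he : 1 ≤ Real.exp (-b * s) := Real.one_le_exp (by nlinarith)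
  rw [add_mul]
  rcases le_total (t + s) 0 with h | h
  · have h1 := hC _ h
    rw [hxz _ h] at h1
    have h2 : Real.exp (-b * (t + s)) ≤ Real.exp (-b * s) := Real.exp_le_exp.2 (by nlinarith)
    have h3 : C * Real.exp (-b * (t + s)) ≤ |C| * Real.exp (-b * s) :=
      mul_le_mul (le_abs_self C) h2 (Real.exp_pos _).le (abs_nonneg C)
    have h4 : 0 ≤ |D| * Real.exp (-b * s) := by positivity
    linarith
  · have h1 := hD (t + s) ⟨h, by linarith⟩
    have h3 : |D| ≤ |D| * Real.exp (-b * s) := le_mul_of_one_le_right (abs_nonneg D) he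
    have h4 : 0 ≤ |C| * Real.exp (-b * s) := by positivity
    linarith [le_abs_self D]

end Continuation

/-! ### Graphs of random continuous maps as random sets -/

section RandomSet

variable {Ω H₁ H₂ : Type*} [MeasurableSpace Ω] [NormedAddCommGroup H₁] [NormedAddCommGroup H₂]
  [MeasurableSpace H₁] [BorelSpace H₁]
  [TopologicalSpace.SeparableSpace H₂]

/-- By continuity of `h ω` the distance to the graph is an infimum over a countable dense set of
`ξ`, hence measurable. -/
theorem isRandomSet_graph {M : Ω → Set (H₁ × H₂)} {h : Ω → H₂ → H₁}
    (hM : ∀ ω, M ω = {ζ | ∃ ξ : H₂, ζ = (h ω ξ, ξ)}) (hc : ∀ ω, Continuous (h ω))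
    (hm : ∀ ξ, Measurable fun ω => h ω ξ) : IsRandomSet M where
  nonempty ω := by
    rw [hM]
    exact ⟨(h ω 0, 0), 0, rfl⟩
  isClosed ω := by
    have : M ω = {ζ | ζ.1 = h ω ζ.2} := by
      rw [hM]
      ext ζ
      constructor
      · rintro ⟨ξ, rfl⟩; rfl
      · intro hζ; exact ⟨ζ.2, Prod.ext hζ rfl⟩
    rw [this]
    exact isClosed_eq continuous_fst ((hc ω).comp continuous_snd)
  measurable_dist w := by
    obtain ⟨D, hDc, hD⟩ := TopologicalSpace.exists_countable_dense H₂
    have : Countable D := hDc.to_subtype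
    have key : ∀ ω, (⨅ z : M ω, (‖z.1.1 - w.1‖ + ‖z.1.2 - w.2‖)) =
        ⨅ ξ : D, (‖h ω ξ - w.1‖ + ‖(ξ : H₂) - w.2‖) := by
      intro ω
      have hmem : ∀ ξ : H₂, (h ω ξ, ξ) ∈ M ω := fun ξ => by rw [hM]; exact ⟨ξ, rfl⟩
      have hsurj : Function.Surjective fun ξ : H₂ => (⟨(h ω ξ, ξ), hmem ξ⟩ : M ω) := by
        rintro ⟨ζ, hζ⟩
        have hζ' := hζ
        rw [hM] at hζ'
        obtain ⟨ξ, rfl⟩ := hζ'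
        exact ⟨ξ, rfl⟩
      have hcont : Continuous fun ξ : H₂ => ‖h ω ξ - w.1‖ + ‖ξ - w.2‖ := by
        have := hc ω
        fun_prop
      rw [hD.ciInf' hcont]
      exact (hsurj.iInf_congr _ fun ξ => rfl).symm
    simp_rw [key]
    exact Measurable.iInf fun ξ => ((hm ξ).sub_const w.1).norm.add_const _

end RandomSet

/-! ### Nonlinearity plus noise as a time-dependent drift -/

section Drift

variable {H₁ H₂ : Type*} [NormedAddCommGroup H₁] [NormedSpace ℝ H₁] [NormedAddCommGroup H₂]

/-- The nonlinearity and the noise of the slow equation. -/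
noncomputable def slowDrift (f : H₁ × H₂ → H₁) (σ : H₁) (ε μ : ℝ) (ω : PathSpace) (s : ℝ)
    (p : H₁ × H₂) : H₁ :=
  (1 / ε) • f p + (1 / √ε) • (ou μ s ω • σ)

theorem slowDrift_shift {G : Type*} (f : H₁ × G → H₁) (σ : H₁) (ε μ : ℝ) (ω : PathSpace) (t s : ℝ) :
    slowDrift f σ ε μ (shift t ω) s = slowDrift f σ ε μ ω (t + s) := by
  funext p
  simp only [slowDrift, add_comm t s, ou_add]

theorem continuous_of_lipschitz_sum_norm {G₁ G₂ G : Type*} [NormedAddCommGroup G₁]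
    [NormedAddCommGroup G₂] [NormedAddCommGroup G] {f : G₁ × G₂ → G} {K : ℝ} (hK : 0 ≤ K)
    (hf : ∀ (x₁ x₂ : G₁) (y₁ y₂ : G₂), ‖f (x₁, y₁) - f (x₂, y₂)‖ ≤ K * (‖x₁ - x₂‖ + ‖y₁ - y₂‖)) :
    Continuous f := by
  refine (LipschitzWith.of_dist_le_mul (K := (2 * K).toNNReal) fun p q => ?_).continuous
  rw [dist_eq_norm, dist_eq_norm, Real.coe_toNNReal _ (by positivity)]
  have h1 := hf p.1 q.1 p.2 q.2
  have h2 := mul_le_mul_of_nonneg_left (sum_norm_le_two_mul (p - q)) hK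
  simp only [Prod.fst_sub, Prod.snd_sub] at h2
  linarith

/-- The noise is additive, so it cancels in differences and leaves the Lipschitz constant `K / ε`.
At the zero state only the noise survives, and temperedness at rate `b` bounds it. -/
theorem isNonlinearity_slowDrift {f : H₁ × H₂ → H₁} {g : H₁ × H₂ → H₂} {σ : H₁} {K ε μ b : ℝ}
    (hf0 : f (0, 0) = 0) (hg0 : g (0, 0) = 0) (hK : 0 ≤ K) (hε : 0 < ε) (hμ : 0 < μ) (hb : 0 < b)
    (hf : ∀ (x₁ x₂ : H₁) (y₁ y₂ : H₂), ‖f (x₁, y₁) - f (x₂, y₂)‖ ≤ K * (‖x₁ - x₂‖ + ‖y₁ - y₂‖))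
    (hg : ∀ (x₁ x₂ : H₁) (y₁ y₂ : H₂), ‖g (x₁, y₁) - g (x₂, y₂)‖ ≤ K * (‖x₁ - x₂‖ + ‖y₁ - y₂‖))
    (ω : PathSpace) :
    IsNonlinearity (slowDrift f σ ε μ ω) (fun _ => g) b (K / ε) K where
  continuous_left := by
    have h1 := continuous_of_lipschitz_sum_norm hK hf
    have h2 := continuous_ou hμ ω
    unfold slowDrift Function.uncurry
    fun_prop
  continuous_right := (continuous_of_lipschitz_sum_norm hK hg).comp continuous_snd
  lipschitz_left s p q := by
    simp only [slowDrift, add_sub_add_right_eq_sub, ← smul_sub, norm_smul]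
    rw [Real.norm_of_nonneg (by positivity)]
    refine (mul_le_mul_of_nonneg_left (hf p.1 q.1 p.2 q.2) (by positivity)).trans (le_of_eq ?_)
    simp only [Prod.fst_sub, Prod.snd_sub]
    ring
  lipschitz_right _ p q := hg p.1 q.1 p.2 q.2
  growth_left := by
    obtain ⟨C, hC0, hC⟩ := exists_ou_le_exp hμ ω hb
    refine ⟨1 / √ε * C * ‖σ‖, fun s hs => ?_⟩
    have h0 : f 0 = 0 := hf0
    simp only [slowDrift, h0, smul_zero, zero_add, norm_smul]
    rw [Real.norm_of_nonneg (by positivity), Real.norm_eq_abs]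
    have h1 := hC s
    rw [abs_of_nonpos hs, mul_neg, ← neg_mul] at h1
    calc 1 / √ε * (|ou μ s ω| * ‖σ‖) ≤ 1 / √ε * (C * Real.exp (-b * s) * ‖σ‖) := by gcongr
      _ = _ := by ring
  growth_right := ⟨0, fun s _ => by
    have h0 : g 0 = 0 := hg0
    simp [h0]⟩

theorem slowDrift_growth_forward {f : H₁ × H₂ → H₁} {σ : H₁} {ε μ : ℝ} (hf0 : f (0, 0) = 0)
    (hμ : 0 < μ) (ω : PathSpace) :
    ∃ C, ∀ s, 0 ≤ s → ‖slowDrift f σ ε μ ω s 0‖ ≤ C * Real.exp s := by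
  obtain ⟨C, hC0, hC⟩ := exists_ou_le_exp hμ ω one_pos
  refine ⟨1 / √ε * C * ‖σ‖, fun s hs => ?_⟩
  have h0 : f 0 = 0 := hf0
  simp only [slowDrift, h0, smul_zero, zero_add, norm_smul]
  rw [Real.norm_of_nonneg (by positivity), Real.norm_eq_abs]
  have h1 := hC s
  rw [abs_of_nonneg hs, one_mul] at h1
  calc 1 / √ε * (|ou μ s ω| * ‖σ‖) ≤ 1 / √ε * (C * Real.exp s * ‖σ‖) := by gcongr
    _ = _ := by ring

theorem measurable_slowDrift [MeasurableSpace H₁] [BorelSpace H₁] [SecondCountableTopology H₁]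
    [MeasurableSpace H₂] [BorelSpace H₂] [SecondCountableTopology H₂]
    {f : H₁ × H₂ → H₁} (hf : Continuous f) (σ : H₁) (ε μ : ℝ) :
    Measurable fun q : PathSpace × ℝ × H₁ × H₂ => slowDrift f σ ε μ q.1 q.2.1 q.2.2 := by
  have h1 : Measurable fun q : PathSpace × ℝ × H₁ × H₂ => f q.2.2 :=
    hf.measurable.comp (by fun_prop)
  have h2 : Measurable fun q : PathSpace × ℝ × H₁ × H₂ => ou μ q.2.1 q.1 :=
    (measurable_ou μ).comp (f := fun q : PathSpace × ℝ × H₁ × H₂ => (q.2.1, q.1)) (by fun_prop)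
  exact (h1.const_smul _).add ((h2.smul_const σ).const_smul _)

end Drift

/-! ### Translation of the given equations into the abstract ones -/

section System

variable {H₁ H₂ : Type*} [NormedAddCommGroup H₁] [InnerProductSpace ℝ H₁]
  [NormedAddCommGroup H₂] [InnerProductSpace ℝ H₂]
  {S : ℝ → H₁ →L[ℝ] H₁} {U : ℝ → H₂ →L[ℝ] H₂} {f : H₁ × H₂ → H₁} {g : H₁ × H₂ → H₂}

/-- On the range of integration `t - s ≥ 0`, so freezing the semigroup at negative times changes
nothing, and linearity merges the two integrals into one. -/
theorem mildEq_iff [CompleteSpace H₁] (hS : IsContSemigroup fun t => S (max t 0))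
    (hf : Continuous f) {σ : H₁} {ε μ : ℝ} (hε : 0 < ε) (hμ : 0 < μ) {ω : PathSpace}
    {z : ℝ → H₁ × H₂} {τ t : ℝ} (hτt : τ ≤ t) (hz : ContinuousOn z (Icc τ t)) :
    MildEq S U f g σ ε μ ω z τ t ↔
      (z t).1 = S (max ((t - τ) / ε) 0) (z τ).1 +
        (∫ s in τ..t, S (max ((t - s) / ε) 0) (slowDrift f σ ε μ ω s (z s))) ∧
      (z t).2 = U (t - τ) (z τ).2 + ∫ s in τ..t, U (t - s) (g (z s)) := by
  rw [← uIcc_of_le hτt] at hz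
  have hmax : ∀ s ∈ uIcc τ t, max ((t - s) / ε) 0 = (t - s) / ε := by
    intro s hs
    rw [uIcc_of_le hτt] at hs
    exact max_eq_left (div_nonneg (sub_nonneg.2 hs.2) hε.le)
  have hSε := hS.comp_div hε
  have h1 := (hSε.intervalIntegrable_conv (φ := fun s => f (z s)) (hf.comp_continuousOn hz) t).smul
    (1 / ε)
  have h2 := (hSε.intervalIntegrable_conv (φ := fun s => ou μ s ω • σ) (a := τ) (b := t)
    ((continuous_ou hμ ω).smul continuous_const).continuousOn t).smul (1 / √ε)
  have h3 : ∫ s in τ..t, S (max ((t - s) / ε) 0) (slowDrift f σ ε μ ω s (z s)) =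
      (1 / ε) • (∫ s in τ..t, S ((t - s) / ε) (f (z s))) +
        (1 / √ε) • (∫ s in τ..t, ou μ s ω • S ((t - s) / ε) σ) := by
    have e1 : ∫ s in τ..t, S ((t - s) / ε) (f (z s)) =
        ∫ s in τ..t, S (max ((t - s) / ε) 0) (f (z s)) :=
      intervalIntegral.integral_congr fun s hs => by simp only [hmax s hs]
    have e2 : ∫ s in τ..t, ou μ s ω • S ((t - s) / ε) σ =
        ∫ s in τ..t, S (max ((t - s) / ε) 0) (ou μ s ω • σ) :=
      intervalIntegral.integral_congr fun s hs => by simp only [hmax s hs, map_smul]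
    rw [e1, e2, ← intervalIntegral.integral_smul, ← intervalIntegral.integral_smul,
      ← intervalIntegral.integral_add (f := fun s => (1 / ε) • S (max ((t - s) / ε) 0) (f (z s)))
        (g := fun s => (1 / √ε) • S (max ((t - s) / ε) 0) (ou μ s ω • σ)) h1 h2]
    simp only [slowDrift, map_add, map_smul]
  rw [h3, hmax τ left_mem_uIcc, ← add_assoc]
  rfl

theorem mem_slowManifold_iff [CompleteSpace H₁] (hS : IsContSemigroup fun t => S (max t 0))
    (hf : Continuous f) {σ : H₁} {ρ ε μ : ℝ} (hε : 0 < ε) (hμ : 0 < μ) {ω : PathSpace}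
    {ζ : H₁ × H₂} :
    ζ ∈ slowManifold S U f g σ ρ ε μ ω ↔
      ∃ z, IsWeightedBackwardSolution (fun t => S (max (t / ε) 0)) U (slowDrift f σ ε μ ω)
        (fun _ => g) (ρ / ε) z ∧ z 0 = ζ := by
  have hsub : ∀ {τ t : ℝ}, t ≤ 0 → Icc τ t ⊆ Iic 0 := fun ht s hs => hs.2.trans ht
  have hexp : ∀ t : ℝ, Real.exp (-(-(ρ / ε)) * t) * Real.exp (-(ρ / ε) * t) = 1 := by
    intro t
    rw [← Real.exp_add]
    simp
  constructor
  · rintro ⟨z, hz, ⟨-, C₁, h₁⟩, -, C₂, h₂⟩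
    refine ⟨z, ⟨hz.continuousOn, ⟨C₁ + C₂, fun s hs => ?_⟩, fun τ t hτt ht => ?_,
      fun τ t hτt ht => ?_⟩, hz.final⟩
    · have h3 := add_le_add (h₁ s hs) (h₂ s hs)
      rw [← mul_add] at h3
      calc ‖z s‖ ≤ ‖(z s).1‖ + ‖(z s).2‖ := norm_le_sum_norm _
        _ = (Real.exp (-(-(ρ / ε)) * s) * (‖(z s).1‖ + ‖(z s).2‖)) * Real.exp (-(ρ / ε) * s) := by
          rw [mul_right_comm, hexp, one_mul]
        _ ≤ _ := by gcongr
    · exact ((mildEq_iff hS hf hε hμ hτt (hz.continuousOn.mono (hsub ht))).1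
        (hz.mild τ t hτt ht)).1
    · exact ((mildEq_iff hS hf hε hμ hτt (hz.continuousOn.mono (hsub ht))).1
        (hz.mild τ t hτt ht)).2
  · rintro ⟨z, hz, h0⟩
    obtain ⟨C, hC⟩ := hz.bound
    have hw : ∀ r s, s ≤ 0 → r ≤ ‖z s‖ → Real.exp (-(-(ρ / ε)) * s) * r ≤ C := by
      intro r s hs hr
      calc Real.exp (-(-(ρ / ε)) * s) * r
          ≤ Real.exp (-(-(ρ / ε)) * s) * (C * Real.exp (-(ρ / ε) * s)) := by
            gcongr
            exact hr.trans (hC s hs)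
        _ = C := by rw [mul_left_comm, hexp, mul_one]
    refine ⟨z, ⟨hz.continuousOn, h0, fun τ t hτt ht => ?_⟩,
      ⟨hz.continuousOn.fst, C, fun s hs => hw _ s hs (norm_fst_le _)⟩,
      ⟨hz.continuousOn.snd, C, fun s hs => hw _ s hs (norm_snd_le _)⟩⟩
    exact (mildEq_iff hS hf hε hμ hτt (hz.continuousOn.mono (hsub ht))).2
      ⟨hz.left τ t hτt ht, hz.right τ t hτt ht⟩

end System

end WongZakai

theorem proposition1
    {H₁ H₂ : Type*}
    [NormedAddCommGroup H₁] [InnerProductSpace ℝ H₁] [CompleteSpace H₁]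
    [TopologicalSpace.SeparableSpace H₁] [MeasurableSpace H₁] [BorelSpace H₁]
    [NormedAddCommGroup H₂] [InnerProductSpace ℝ H₂] [CompleteSpace H₂]
    [TopologicalSpace.SeparableSpace H₂] [MeasurableSpace H₂] [BorelSpace H₂]
    -- the Wiener measure on the canonical path space
    (P : Measure PathSpace) (hP : IsWienerMeasure P)
    -- the linear operators, with the semigroup `S t = e^{At}` and the group `U t = e^{Bt}`
    (A : H₁ →ₗ.[ℝ] H₁) (S : ℝ → H₁ →L[ℝ] H₁) (hS : IsC0Semigroup S)
    (hA : IsSemigroupGenerator A S)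
    (B : H₂ →ₗ.[ℝ] H₂) (U : ℝ → H₂ →L[ℝ] H₂) (hU : IsC0Group U) (hB : IsGroupGenerator B U)
    -- the nonlinearities and the noise intensity
    (f : H₁ × H₂ → H₁) (g : H₁ × H₂ → H₂) (hf0 : f (0, 0) = 0) (hg0 : g (0, 0) = 0)
    (σ : H₁) (hσ : σ ∈ A.domain)
    (γ₁ γ₂ K ρ ε : ℝ)
    -- (A1)
    (hγ₁ : 0 < γ₁) (hS_bound : ∀ t : ℝ, 0 ≤ t → ∀ x : H₁, ‖S t x‖ ≤ Real.exp (-γ₁ * t) * ‖x‖)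
    (hγ₂ : 0 < γ₂) (hU_bound : ∀ t : ℝ, t ≤ 0 → ∀ y : H₂, ‖U t y‖ ≤ Real.exp (-γ₂ * t) * ‖y‖)
    -- (A2)
    (hK : 0 < K)
    (hf : ∀ (x₁ x₂ : H₁) (y₁ y₂ : H₂),
      ‖f (x₁, y₁) - f (x₂, y₂)‖ ≤ K * (‖x₁ - x₂‖ + ‖y₁ - y₂‖))
    (hg : ∀ (x₁ x₂ : H₁) (y₁ y₂ : H₂),
      ‖g (x₁, y₁) - g (x₂, y₂)‖ ≤ K * (‖x₁ - x₂‖ + ‖y₁ - y₂‖))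
    -- (A3)
    (hKγ : K < γ₁)
    -- the exponent `ρ` and the scale parameter `ε`
    (hρ : 0 < ρ) (hρK : K < γ₁ - ρ)
    (hε : 0 < ε) (hε_lt : ε < ρ / (γ₂ + 1 / (1 / K - 1 / (γ₁ - ρ)))) :
    ∀ μ : ℝ, 0 < μ →
      ∃ φ : ℝ≥0 → PathSpace → H₁ × H₂ → H₁ × H₂,
        IsSolutionMap S U f g σ ε μ φ ∧
        IsRandomDynamicalSystem P shift φ ∧
        ∃ h : PathSpace → H₂ → H₁,
          IsRandomSlowManifold shift φ (slowManifold S U f g σ ρ ε μ) h ∧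
          ∀ (ω : PathSpace) (ξ₁ ξ₂ : H₂),
            ‖h ω ξ₁ - h ω ξ₂‖ ≤
              K / ((γ₁ - ρ) * (1 - K * (1 / (γ₁ - ρ) + ε / (ρ - ε * γ₂)))) * ‖ξ₁ - ξ₂‖ := by
  intro μ hμ
  have : SecondCountableTopology H₁ := UniformSpace.secondCountable_of_separable H₁
  have : SecondCountableTopology H₂ := UniformSpace.secondCountable_of_separable H₂
  have hSc : IsContSemigroup fun t => S (max t 0) := hS.isContSemigroup fun t ht x =>
    (hS_bound t ht x).trans (mul_le_of_le_one_left (norm_nonneg x)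
      (Real.exp_le_one_iff.2 (by nlinarith)))
  have hSε : IsContSemigroup fun t => S (max (t / ε) 0) := hSc.comp_div hε
  have hUc : IsContSemigroup U := hU.isContSemigroup
  have hfc : Continuous f := continuous_of_lipschitz_sum_norm hK.le hf
  have hgc : Continuous g := continuous_of_lipschitz_sum_norm hK.le hg
  have hγρ : 0 < γ₁ - ρ := hK.trans hρK
  have hδ : 0 < 1 / K - 1 / (γ₁ - ρ) := sub_pos.2 (one_div_lt_one_div_of_lt hK hρK)
  have hε' : ε * γ₂ + ε * (1 / (1 / K - 1 / (γ₁ - ρ))) < ρ := by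
    rw [lt_div_iff₀ (by positivity), mul_add] at hε_lt
    exact hε_lt
  have hρε : 0 < ρ - ε * γ₂ := by
    have : 0 < ε * (1 / (1 / K - 1 / (γ₁ - ρ))) := by positivity
    linarith
  have hL₁ : K / ε / (γ₁ / ε - ρ / ε) = K / (γ₁ - ρ) := by
    rw [← sub_div, div_div_div_cancel_right₀ hε.ne']
  have hL₂ : K / (ρ / ε - γ₂) = K * (ε / (ρ - ε * γ₂)) := by
    have : ρ / ε - γ₂ = (ρ - ε * γ₂) / ε := by field_simp
    rw [this]
    field_simp
  -- In the first term `ε` cancels; the bound on `ε` gives `ε / (ρ - ε * γ₂) < 1 / K - 1 / (γ₁ -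
  -- ρ)`, and multiplication by `K` gives the claim.
  have hgap : K / ε / (γ₁ / ε - ρ / ε) + K / (ρ / ε - γ₂) < 1 := by
    rw [hL₁, hL₂]
    have h1 : ε / (ρ - ε * γ₂) < 1 / K - 1 / (γ₁ - ρ) := by
      rw [div_lt_iff₀ hρε]
      have h2 : ε * (1 / (1 / K - 1 / (γ₁ - ρ))) < ρ - ε * γ₂ := by linarith
      rwa [mul_one_div, div_lt_iff₀ hδ, mul_comm] at h2
    have h3 := mul_lt_mul_of_pos_left h1 hK
    have h4 : K * (1 / K - 1 / (γ₁ - ρ)) = 1 - K / (γ₁ - ρ) := by field_simp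
    linarith
  have hb : 0 < ρ / ε := by positivity
  have hd : IsDichotomy (fun t => S (max (t / ε) 0)) U (γ₁ / ε) (ρ / ε) γ₂ (K / ε) K :=
    { semigroup := hSε
      group := hUc
      group_add := hU.map_add
      norm_semigroup_le := fun t ht x => by
        have h1 : 0 ≤ t / ε := by positivity
        have h2 := hS_bound _ h1 x
        rw [max_eq_left h1]
        refine h2.trans (le_of_eq ?_)
        congr 2
        ring
      norm_group_le := hU_bound
      lt_weight := by rw [lt_div_iff₀ hε]; linarith
      weight_lt := by gcongr; linarith
      nonneg_left := by positivity
      nonneg_right := hK.le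
      gap := hgap }
  have hN := isNonlinearity_slowDrift (σ := σ) hf0 hg0 hK.le hε hμ hb hf hg
  have hF₁m := measurable_slowDrift hfc σ ε μ
  have hF₂m : Measurable fun q : PathSpace × ℝ × H₁ × H₂ => g q.2.2 :=
    hgc.measurable.comp (by fun_prop)
  set V : ℝ → (H₁ × H₂) →L[ℝ] (H₁ × H₂) := fun t => (S (max (t / ε) 0)).prodMap (U t) with hVdef
  set F : PathSpace → ℝ → H₁ × H₂ → H₁ × H₂ := fun ω s p => (slowDrift f σ ε μ ω s p, g p)
    with hFdef
  have hV : IsContSemigroup V := hSε.prodMap hUc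
  have hFc : ∀ ω, Continuous (Function.uncurry (F ω)) := fun ω =>
    (hN ω).continuous_left.prodMk (hN ω).continuous_right
  -- The factor `2` passes from the sum norm of the hypotheses to the maximum norm of the product.
  have hFL : ∀ ω s p q, ‖F ω s p - F ω s q‖ ≤ 2 * (K / ε + K) * ‖p - q‖ := by
    intro ω s p q
    have h1 := (hN ω).lipschitz_left s p q
    have h2 := (hN ω).lipschitz_right s p q
    have h3 := norm_le_sum_norm (F ω s p - F ω s q)
    have h4 := mul_le_mul_of_nonneg_left (sum_norm_le_two_mul (p - q))
      (show 0 ≤ K / ε + K by positivity)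
    simp only [hFdef, Prod.fst_sub, Prod.snd_sub, Prod.mk_sub_mk] at h1 h2 h3 h4 ⊢
    linarith
  have hF0 : ∀ ω, ∃ C, ∀ s, 0 ≤ s → ‖F ω s 0‖ ≤ C * Real.exp s := by
    intro ω
    obtain ⟨C, hC⟩ := slowDrift_growth_forward (σ := σ) (ε := ε) hf0 hμ ω
    refine ⟨C, fun s hs => ?_⟩
    have h0 : g 0 = 0 := hg0
    refine (norm_le_sum_norm _).trans ?_
    simpa [hFdef, h0] using hC s hs
  have hFshift : ∀ ω t, F (shift t ω) = fun s => F ω (t + s) := by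
    intro ω t
    funext s p
    simp only [hFdef, slowDrift_shift]
  obtain ⟨Z, hZc, hZ0, hZm, hZmeas⟩ := exists_measurable_forward_flow hV (F := F)
    (hF₁m.prodMk hF₂m) hFc (by positivity) hFL hF0
  obtain ⟨h, hgraph, hlip, hmeas⟩ := exists_measurable_graph hd hN hF₁m hF₂m
  have hmild : ∀ {ω : PathSpace} {z : ℝ → H₁ × H₂} {τ t : ℝ}, τ ≤ t → ContinuousOn z (Icc τ t) →
      (MildEq S U f g σ ε μ ω z τ t ↔ Mild V (F ω) z τ t) := fun {ω} _ _ _ hτt hz =>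
    (mildEq_iff hSc hfc hε hμ hτt hz).trans
      (mild_prodMap_iff hSε hUc (hN ω).continuous_left (hN ω).continuous_right hτt hz).symm
  have hIcc : ∀ t : ℝ, Icc 0 t ⊆ Ici 0 := fun _ => Icc_subset_Ici_self
  have huniq : ∀ (ω : PathSpace) (z : ℝ → H₁ × H₂), ContinuousOn z (Ici 0) →
      (∀ t, 0 ≤ t → Mild V (F ω) z 0 t) → ∀ t, 0 ≤ t → z t = Z ω (z 0) t :=
    fun ω z hz hm t ht => mild_unique hV (hFc ω) (by positivity) (hFL ω) hz
      (hZc ω (z 0)).continuousOn (hZ0 ω (z 0)).symm hm (hZm ω (z 0)) ht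
  have hmem : ∀ ω ζ, ζ ∈ slowManifold S U f g σ ρ ε μ ω ↔ ζ.1 = h ω ζ.2 := fun ω ζ =>
    (mem_slowManifold_iff hSc hfc hε hμ).trans (hgraph ω ζ)
  have heq : ∀ ω, slowManifold S U f g σ ρ ε μ ω = {ζ | ∃ ξ : H₂, ζ = (h ω ξ, ξ)} := by
    intro ω
    ext ζ
    rw [hmem]
    constructor
    · intro hζ
      exact ⟨ζ.2, Prod.ext hζ rfl⟩
    · rintro ⟨ξ, rfl⟩
      rfl
  have hlip' : ∀ (ω : PathSpace) (ξ₁ ξ₂ : H₂), ‖h ω ξ₁ - h ω ξ₂‖ ≤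
      K / ((γ₁ - ρ) * (1 - K * (1 / (γ₁ - ρ) + ε / (ρ - ε * γ₂)))) * ‖ξ₁ - ξ₂‖ := by
    intro ω ξ₁ ξ₂
    refine (hlip ω ξ₁ ξ₂).trans (le_of_eq ?_)
    rw [hL₁, hL₂, mul_add K, mul_one_div, ← div_div]
    ring
  have hlipw : ∀ ω, LipschitzWith
      (K / ((γ₁ - ρ) * (1 - K * (1 / (γ₁ - ρ) + ε / (ρ - ε * γ₂))))).toNNReal (h ω) := by
    intro ω
    refine LipschitzWith.of_dist_le_mul fun ξ₁ ξ₂ => ?_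
    rw [dist_eq_norm, dist_eq_norm]
    exact (hlip' ω ξ₁ ξ₂).trans
      (mul_le_mul_of_nonneg_right (Real.le_coe_toNNReal _) (norm_nonneg _))
  refine ⟨fun t ω ζ => Z ω ζ t, fun ω ζ z => ⟨fun hz t => ?_, fun hz => ?_⟩,
    ⟨isMetricDynamicalSystem_shift hP, ?_, fun ω => ?_, fun s t ω => ?_⟩, h,
    ⟨isRandomSet_graph heq (fun ω => (hlipw ω).continuous) hmeas, heq, fun t ω => ?_,
      fun ω => ⟨_, hlipw ω⟩, hmeas⟩, hlip'⟩
  · rw [← hz.initial]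
    exact huniq ω z hz.continuousOn (fun r hr => (hmild hr (hz.continuousOn.mono (hIcc _))).1
      (hz.mild r hr)) t t.2
  · have hz' : ∀ t, 0 ≤ t → z t = Z ω ζ t := fun t ht => hz ⟨t, ht⟩
    have hc : ContinuousOn z (Ici 0) := (hZc ω ζ).continuousOn.congr hz'
    exact ⟨hc, (hz' 0 le_rfl).trans (hZ0 ω ζ), fun t ht => (hmild ht (hc.mono (hIcc _))).2
      ((hZm ω ζ t ht).congr ht fun s hs => (hz' s hs.1).symm)⟩
  · exact hZmeas.comp (f := fun p : ℝ≥0 × PathSpace × H₁ × H₂ => ((p.2.1, p.2.2), (p.1 : ℝ)))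
      (by fun_prop)
  · funext ζ
    exact hZ0 ω ζ
  · funext ζ
    have hc : Continuous fun r => Z ω ζ (s + r) := (hZc ω ζ).comp (continuous_const_add _)
    -- Restarted at time `s`, the solution solves the equation driven by the shifted path, so
    -- uniqueness identifies it with the flow there.
    have := huniq (shift s ω) (fun r => Z ω ζ (s + r)) hc.continuousOn (fun r hr => by
      rw [hFshift, Mild.comp_add, add_zero]
      exact ((hZm ω ζ s s.2).iff_of_left hV (hFc ω) s.2 (le_add_of_nonneg_right hr)
        (hZc ω ζ).continuousOn).2 (hZm ω ζ _ (add_nonneg s.2 hr))) t t.2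
    simp only [add_zero] at this
    simpa [add_comm] using this
  · rintro _ ⟨ζ, hζ, rfl⟩
    obtain ⟨z, hz, hz0⟩ := (mem_slowManifold_iff hSc hfc hε hμ).1 hζ
    obtain ⟨hzc, hzb, hzm⟩ := (isWeightedBackwardSolution_iff_mild hSε hUc
      (hN ω).continuous_left (hN ω).continuous_right).1 hz
    -- Invariance: the past of `ζ`, prolonged by the flow up to time `t`, is an admissible past of
    -- `φ t ω ζ` for the path `shift t ω`.
    obtain ⟨y, hy0, hyc, hyb, hym⟩ := exists_backward_continuation hV (hFc ω) hzc hb.le hzb hzm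
      (hZc ω ζ) (by rw [hz0, hZ0]) (hZm ω ζ) t.2
    refine (mem_slowManifold_iff hSc hfc hε hμ).2 ⟨y, ?_, hy0⟩
    refine (isWeightedBackwardSolution_iff_mild hSε hUc
      (hN (shift t ω)).continuous_left (hN (shift t ω)).continuous_right).2 ⟨hyc, hyb, fun τ r hτr hr => ?_⟩
    have := hym τ r hτr hr
    rw [← hFshift] at this
    exact this
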